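/- **($N$-peakon dynamical system of the 3CH system.)** The three-component Camassa–Holm (3CH) system for real functions $u_{11},u_{12},u_{21}$ of $(t,x)$ is $$\begin{aligned} m_{11,t}&=\tfrac12[m_{11}f]_x+\tfrac12 m_{12}(u_{11,x}u_{21}-u_{11}u_{21,x})-\tfrac12 m_{21}(u_{11}u_{12,x}-u_{11,x}u_{12}),\\ m_{12,t}&=\tfrac12[m_{12}f]_x+m_{11}(u_{11}u_{12,x}-u_{11,x}u_{12})+\tfrac12 m_{12}(u_{12,x}u_{21}-u_{12}u_{21,x}),\\ m_{21,t}&=\tfrac12[m_{21}f]_x+m_{11}(u_{11}u_{21,x}-u_{11,x}u_{21})+\tfrac12 m_{21}(u_{12}u_{21,x}-u_{12,x}u_{21}), \end{aligned}$$ where $m_{ab}=u_{ab}-u_{ab,xx}$ and $f=u_{11}^2-u_{11,x}^2+u_{12}u_{21}-u_{12,x}u_{21,x}$. For an open set $I\subseteq\mathbb R$ of times, a triple of functions continuous on $I\times\mathbb R$ is a *weak (distributional) solution* on $I\times\mathbb R$ if each of the three equations holds in $\mathcal D'(I\times\mathbb R)$, where the linear terms are distributional derivatives and the right-hand side is understood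 as the distributional limit, as $\varepsilon\downarrow0$, of the same expression for the mollified functions $u_{ab}^\varepsilon(t,\cdot)=\rho_\varepsilon*u_{ab}(t,\cdot)$, $\rho_\varepsilon(x)=\varepsilon^{-1}\rho(x/\varepsilon)$, the limit being required to exist and to satisfy the equation for every $\rho\in C_c^\infty(\mathbb R)$ with $\rho\ge0$ and $\int\rho=1$. Explicitly, an equation $m_t=A_x+B$ with $m=u-u_{xx}$ means $$\lim_{\varepsilon\downarrow0}\iint\left(-A^\varepsilon\varphi_x+B^\varepsilon\varphi\right)dx\,dt=-\iint u\,(\varphi_t-\varphi_{txx})\,dx\,dt\qquad\text{for all }\varphi\in C_c^\infty(I\times\mathbb R).$$ Let $N\ge0$ and let $p_j,r_j,s_j,q_j:I\to\mathbb R$ ($1\le j\le N$) be continuous. Call $t\in I$ *regular* if $q_1(t),\dots,q_N(t)$ are pairwise distinct. Suppose that at most countably many times in $I$ are not regular (collision times) and that $p_j,r_j,s_j,q_j$ are $C^1$ on the open set of regular times. Put $$u_{11}=\sum_{j=1}^N p_j(t)e^{-|x-q_j(t)|},\quad u_{12}=\sum_{j=1}^N r_j(t)e^{-|x-q_j(t)|},\quad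 u_{21}=\sum_{j=1}^N s_j(t)e^{-|x-q_j(t)|}.$$ With $\operatorname{sgn}0=0$, $\sigma_{ji}=\operatorname{sgn}(q_j-q_i)$ and $E_{jik}=e^{-|q_j-q_i|-|q_j-q_k|}$, consider the system $$\begin{aligned} p_{j,t}&=\tfrac12 r_j\sum_{i,k=1}^N p_is_k(\sigma_{jk}-\sigma_{ji})E_{jik}-\tfrac12 s_j\sum_{i,k=1}^N p_ir_k(\sigma_{ji}-\sigma_{jk})E_{jik},\\ r_{j,t}&=p_j\sum_{i,k=1}^N p_ir_k(\sigma_{ji}-\sigma_{jk})E_{jik}+\tfrac12 r_j\sum_{i,k=1}^N r_is_k(\sigma_{jk}-\sigma_{ji})E_{jik},\\ s_{j,t}&=p_j\sum_{i,k=1}^N p_is_k(\sigma_{ji}-\sigma_{jk})E_{jik}-\tfrac12 s_j\sum_{i,k=1}^N r_is_k(\sigma_{jk}-\sigma_{ji})E_{jik},\\ q_{j,t}&=\tfrac16(p_j^2+r_js_j)-\tfrac12\sum_{i,k=1}^N(p_ip_k+r_is_k)(1-\sigma_{ji}\sigma_{jk})E_{jik} \end{aligned}\qquad(1\le j\le N).\tag{$*$}$$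 1. If $(*)$ holds at every regular time, then $(u_{11},u_{12},u_{21})$ is a weak solution of the 3CH system on $I\times\mathbb R$. 2. If no peakon is void, i.e. if $(p_j(t),r_j(t),s_j(t))\ne(0,0,0)$ for every $j$ and every regular time $t$, then $(u_{11},u_{12},u_{21})$ is a weak solution of the 3CH system on $I\times\mathbb R$ if and only if $(*)$ holds at every regular time. -/

import Mathlib

open Set Filter Topology MeasureTheory
open scoped ContDiff

noncomputable section

namespace ThreeCH

/-- A scalar field `v(t, x)` in one time and one space variable. -/
abbrev Field2 := ℝ → ℝ → ℝ

/-- The space derivative `v_x`. -/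
def dx (v : Field2) : Field2 := fun t x => deriv (fun y => v t y) x

/-- The time derivative `v_t`. -/
def dt (v : Field2) : Field2 := fun t x => deriv (fun τ => v τ x) t

/-- The momentum `m = v - v_xx`. -/
def momentum (v : Field2) : Field2 := fun t x => v t x - dx (dx v) t x

/-- The scalar `u₁₁² - u₁₁,ₓ² + u₁₂ u₂₁ - u₁₂,ₓ u₂₁,ₓ`. -/
def speed (u₁₁ u₁₂ u₂₁ : Field2) : Field2 := fun t x =>
  u₁₁ t x ^ 2 - dx u₁₁ t x ^ 2 + u₁₂ t x * u₂₁ t x - dx u₁₂ t x * dx u₂₁ t x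

/-- The flux `(1/2) m₁₁ (u₁₁² - u₁₁,ₓ² + u₁₂ u₂₁ - u₁₂,ₓ u₂₁,ₓ)`. -/
def flux₁₁ (u₁₁ u₁₂ u₂₁ : Field2) : Field2 := fun t x =>
  1 / 2 * (momentum u₁₁ t x * speed u₁₁ u₁₂ u₂₁ t x)

/-- The flux `(1/2) m₁₂ (u₁₁² - u₁₁,ₓ² + u₁₂ u₂₁ - u₁₂,ₓ u₂₁,ₓ)`. -/
def flux₁₂ (u₁₁ u₁₂ u₂₁ : Field2) : Field2 := fun t x =>
  1 / 2 * (momentum u₁₂ t x * speed u₁₁ u₁₂ u₂₁ t x)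

/-- The flux `(1/2) m₂₁ (u₁₁² - u₁₁,ₓ² + u₁₂ u₂₁ - u₁₂,ₓ u₂₁,ₓ)`. -/
def flux₂₁ (u₁₁ u₁₂ u₂₁ : Field2) : Field2 := fun t x =>
  1 / 2 * (momentum u₂₁ t x * speed u₁₁ u₁₂ u₂₁ t x)

/-- The non-divergence part of the equation for `m₁₁`. -/
def source₁₁ (u₁₁ u₁₂ u₂₁ : Field2) : Field2 := fun t x =>
  1 / 2 * momentum u₁₂ t x * (dx u₁₁ t x * u₂₁ t x - u₁₁ t x * dx u₂₁ t x)
    - 1 / 2 * momentum u₂₁ t x * (u₁₁ t x * dx u₁₂ t x - dx u₁₁ t x * u₁₂ t x)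

/-- The non-divergence part of the equation for `m₁₂`. -/
def source₁₂ (u₁₁ u₁₂ u₂₁ : Field2) : Field2 := fun t x =>
  momentum u₁₁ t x * (u₁₁ t x * dx u₁₂ t x - dx u₁₁ t x * u₁₂ t x)
    + 1 / 2 * momentum u₁₂ t x * (dx u₁₂ t x * u₂₁ t x - u₁₂ t x * dx u₂₁ t x)

/-- The non-divergence part of the equation for `m₂₁`. -/
def source₂₁ (u₁₁ u₁₂ u₂₁ : Field2) : Field2 := fun t x =>
  momentum u₁₁ t x * (u₁₁ t x * dx u₂₁ t x - dx u₁₁ t x * u₂₁ t x)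
    + 1 / 2 * momentum u₂₁ t x * (u₁₂ t x * dx u₂₁ t x - dx u₁₂ t x * u₂₁ t x)

/-- Test functions on the space-time strip `I × ℝ`. -/
structure IsTestFunction (I : Set ℝ) (φ : Field2) : Prop where
  smooth : ContDiff ℝ ∞ (Function.uncurry φ)
  compact : HasCompactSupport (Function.uncurry φ)
  support_subset : tsupport (Function.uncurry φ) ⊆ I ×ˢ (univ : Set ℝ)

/-- Mollifiers on the line: smooth, compactly supported, nonnegative, of integral one. -/
structure IsMollifier (ρ : ℝ → ℝ) : Prop where
  smooth : ContDiff ℝ ∞ ρ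
  compact : HasCompactSupport ρ
  nonneg : ∀ x, 0 ≤ ρ x
  integral_eq_one : ∫ x, ρ x = 1

/-- The mollification `ρ_ε * v` in the space variable, where `ρ_ε(x) = ε⁻¹ ρ(x/ε)`. -/
def mollify (ρ : ℝ → ℝ) (ε : ℝ) (v : Field2) : Field2 := fun t x =>
  ∫ y, ε⁻¹ * ρ ((x - y) / ε) * v t y

/-- The equation `m_t = A_x + B` with `m = v - v_xx`, in the sense of distributions on `I × ℝ`.
Here `A` and `B` are nonlinear differential expressions in the fields `u₁₁, u₁₂, u₂₁`. Their
products of a momentum (which may be a measure) with (possibly discontinuous) first derivatives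
are the distributional limits of the same expressions for the mollified fields, and this limit
must exist and be the same for every mollifier. On the left,
`⟨m_t, φ⟩ = -⟨m, φ_t⟩ = -⟨v, φ_t - φ_txx⟩`. -/
def HoldsWeakly (I : Set ℝ) (v : Field2) (A B : Field2 → Field2 → Field2 → Field2)
    (u₁₁ u₁₂ u₂₁ : Field2) : Prop :=
  ∀ φ : Field2, IsTestFunction I φ → ∀ ρ : ℝ → ℝ, IsMollifier ρ →
    Tendsto
      (fun ε : ℝ => ∫ t, ∫ x,
        (-(A (mollify ρ ε u₁₁) (mollify ρ ε u₁₂) (mollify ρ ε u₂₁) t x * dx φ t x)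
          + B (mollify ρ ε u₁₁) (mollify ρ ε u₁₂) (mollify ρ ε u₂₁) t x * φ t x))
      (𝓝[>] 0)
      (𝓝 (-∫ t, ∫ x, v t x * momentum (dt φ) t x))

/-- Continuous weak (distributional) solutions of the 3CH system on `I × ℝ`. -/
structure IsWeakSolution (I : Set ℝ) (u₁₁ u₁₂ u₂₁ : Field2) : Prop where
  cont₁₁ : ContinuousOn (Function.uncurry u₁₁) (I ×ˢ (univ : Set ℝ))
  cont₁₂ : ContinuousOn (Function.uncurry u₁₂) (I ×ˢ (univ : Set ℝ))
  cont₂₁ : ContinuousOn (Function.uncurry u₂₁) (I ×ˢ (univ : Set ℝ))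
  eq₁₁ : HoldsWeakly I u₁₁ flux₁₁ source₁₁ u₁₁ u₁₂ u₂₁
  eq₁₂ : HoldsWeakly I u₁₂ flux₁₂ source₁₂ u₁₁ u₁₂ u₂₁
  eq₂₁ : HoldsWeakly I u₂₁ flux₂₁ source₂₁ u₁₁ u₁₂ u₂₁

/-- The `N`-peakon field `∑ⱼ aⱼ(t) exp(-|x - qⱼ(t)|)`. -/
def peakons {N : ℕ} (a q : Fin N → ℝ → ℝ) : Field2 := fun t x =>
  ∑ j, a j t * Real.exp (-|x - q j t|)

/-- The times in `I` at which the positions `qⱼ` are pairwise distinct. -/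
def regularTimes {N : ℕ} (I : Set ℝ) (q : Fin N → ℝ → ℝ) : Set ℝ :=
  {t ∈ I | ∀ i j, i ≠ j → q i t ≠ q j t}

/-- The double sum
`∑_{i,k} aᵢ b_k (sgn(qⱼ - qᵢ) - sgn(qⱼ - q_k)) exp(-|qⱼ - qᵢ| - |qⱼ - q_k|)` at time `t`. -/
def W {N : ℕ} (q a b : Fin N → ℝ → ℝ) (j : Fin N) (t : ℝ) : ℝ :=
  ∑ i, ∑ k, a i t * b k t * (Real.sign (q j t - q i t) - Real.sign (q j t - q k t))
    * Real.exp (-|q j t - q i t| - |q j t - q k t|)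

/-- The `N`-peakon dynamical system at time `t`; here `Real.sign 0 = 0`. -/
structure PeakonODEAt {N : ℕ} (p r s q : Fin N → ℝ → ℝ) (t : ℝ) : Prop where
  p_eq : ∀ j, HasDerivAt (p j)
    (-(1 / 2) * r j t * W q p s j t - 1 / 2 * s j t * W q p r j t) t
  r_eq : ∀ j, HasDerivAt (r j)
    (p j t * W q p r j t - 1 / 2 * r j t * W q r s j t) t
  s_eq : ∀ j, HasDerivAt (s j)
    (p j t * W q p s j t + 1 / 2 * s j t * W q r s j t) t
  q_eq : ∀ j, HasDerivAt (q j)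
    (1 / 6 * (p j t ^ 2 + r j t * s j t)
      - 1 / 2 * ∑ i, ∑ k, (p i t * p k t + r i t * s k t)
          * (1 - Real.sign (q j t - q i t) * Real.sign (q j t - q k t))
          * Real.exp (-|q j t - q i t| - |q j t - q k t|)) t

end ThreeCH

end

/-!
For `ε > 0` the mollified momentum of `∑ⱼ cⱼ exp (-|x - qⱼ|)` is `2 ∑ⱼ cⱼ ρ_ε(x - qⱼ)`, because
`exp (-|x|)` is twice the fundamental solution of `1 - ∂ₓ²`. Each nonlinear term of the equations
is such a momentum times a quadratic expression in the mollified fields and their first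
derivatives, so it is tested near the points `qⱼ` only, in the stretched variable
`x = qⱼ + ε z`. There, at a regular time, the fields converge to their values at `qⱼ`, and a
first derivative converges to `V - a S(z)`, where `V` is its average at `qⱼ`, `a` is the amplitude
of the `j`-th peak, and `S(z) = ∫ ρ(w) sgn(z - w) dw`. As `S' = 2 ρ` and `S` runs from `-1` to `1`,
`∫ ρ S = 0` and `∫ ρ S² = 1/3` for every mollifier, even or not (`integral_mul_signProfile`,
`integral_mul_signProfile_sq`). Thus the limits exist and do not depend on `ρ`: antisymmetric
products give the double sums `W` (`convergesTo_bracket`), and the flux gives the right-hand side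
of the equation for `qⱼ`, the constant `1/6` coming from `∫ ρ S²` (`convergesTo_flux`). All limits
are taken by dominated convergence, first in `z`, then in `t` (`convergesTo_momentum_mul`).

Consequently (`isWeakSolution_iff`) the fields form a weak solution if and only if
`∫ ∑ⱼ (cⱼ (φ_t + Qⱼ φ_x) + Rⱼ φ)(t, qⱼ(t)) dt = 0` for all test functions `φ` and for each of the
amplitudes `c = p, r, s`, where `Qⱼ` and `Rⱼ` are the right-hand sides of the equations for `qⱼ`
and `cⱼ`. If these equations hold, the integrand is the derivative of the continuous, compactly
supported function `∑ⱼ cⱼ(t) φ(t, qⱼ(t))` off a countable set, so the integral vanishes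
(`integral_transportDensity_eq_zero`). Conversely, on the open set of regular times an integration
by parts turns the condition into `∑ⱼ ((cⱼ' - Rⱼ) χ(qⱼ) + cⱼ (qⱼ' - Qⱼ) χ'(qⱼ)) = 0` for all `χ`;
the `qⱼ` being distinct, every coefficient vanishes
(`eq_of_integral_transportDensity_eq_zero`). The velocity equation follows wherever one of the
three amplitudes of the peakon is nonzero.
-/

namespace ThreeCH

/-! ### One-dimensional integrals -/

theorem hasDerivAt_integral_Iic {f : ℝ → ℝ} (hf : Continuous f) (hi : Integrable f) (x : ℝ) :
    HasDerivAt (fun y => ∫ w in Iic y, f w) (f x) x := by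
  have h : (fun y => ∫ w in Iic y, f w)
      = fun y => (∫ w in Iic 0, f w) + ∫ w in (0 : ℝ)..y, f w := by
    funext y
    rw [← intervalIntegral.integral_Iic_sub_Iic hi.integrableOn hi.integrableOn]
    ring
  rw [h]
  exact (hf.integral_hasStrictDerivAt 0 x).hasDerivAt.const_add _

theorem integral_Ioi_eq_sub {f : ℝ → ℝ} (hi : Integrable f) (x : ℝ) :
    ∫ w in Ioi x, f w = (∫ w, f w) - ∫ w in Iic x, f w := by
  rw [← intervalIntegral.integral_Iic_add_Ioi (b := x) hi.integrableOn hi.integrableOn]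
  ring

theorem hasDerivAt_integral_Ioi {f : ℝ → ℝ} (hf : Continuous f) (hi : Integrable f) (x : ℝ) :
    HasDerivAt (fun y => ∫ w in Ioi y, f w) (-f x) x := by
  simp_rw [integral_Ioi_eq_sub hi]
  exact (hasDerivAt_integral_Iic hf hi x).const_sub _

theorem measurable_sign : Measurable Real.sign := by
  unfold Real.sign
  exact Measurable.ite measurableSet_Iio measurable_const
    (Measurable.ite measurableSet_Ioi measurable_const measurable_const)

theorem abs_sign_le_one (x : ℝ) : |Real.sign x| ≤ 1 := by
  rcases Real.sign_apply_eq x with h | h | h <;> simp [h]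

theorem continuousAt_sign {x : ℝ} (hx : x ≠ 0) : ContinuousAt Real.sign x := by
  rcases hx.lt_or_gt with h | h
  · refine (continuousAt_const (y := (-1 : ℝ))).congr ?_
    filter_upwards [Iio_mem_nhds h] with y hy using (Real.sign_of_neg hy).symm
  · refine (continuousAt_const (y := (1 : ℝ))).congr ?_
    filter_upwards [Ioi_mem_nhds h] with y hy using (Real.sign_of_pos hy).symm

theorem IsMollifier.integrable {ρ : ℝ → ℝ} (h : IsMollifier ρ) : Integrable ρ :=
  h.smooth.continuous.integrable_of_hasCompactSupport h.compact

theorem IsMollifier.integrable_mul {ρ : ℝ → ℝ} (h : IsMollifier ρ) {g : ℝ → ℝ}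
    (hg : Measurable g) {C : ℝ} (hC : ∀ x, |g x| ≤ C) : Integrable (fun w => ρ w * g w) :=
  h.integrable.mul_bdd hg.aestronglyMeasurable (Eventually.of_forall hC)

theorem IsMollifier.integrable_mul_continuous {ρ : ℝ → ℝ} (h : IsMollifier ρ) {g : ℝ → ℝ}
    (hg : Continuous g) : Integrable (fun w => ρ w * g w) :=
  (h.smooth.continuous.mul hg).integrable_of_hasCompactSupport h.compact.mul_right

theorem IsMollifier.abs_integral_mul_le {ρ : ℝ → ℝ} (h : IsMollifier ρ) {g : ℝ → ℝ}
    {C : ℝ} (hC : ∀ x, |g x| ≤ C) : |∫ w, ρ w * g w| ≤ C := by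
  have : ‖∫ w, ρ w * g w‖ ≤ ∫ w, ρ w * C := by
    refine norm_integral_le_of_norm_le (h.integrable.mul_const C) (Eventually.of_forall fun w => ?_)
    rw [norm_mul, Real.norm_eq_abs, abs_of_nonneg (h.nonneg w)]
    exact mul_le_mul_of_nonneg_left (hC w) (h.nonneg w)
  rwa [integral_mul_const, h.integral_eq_one, one_mul] at this

/-- Dominated convergence against a mollifier. -/
theorem IsMollifier.tendsto_integral_mul {ρ : ℝ → ℝ} (h : IsMollifier ρ) {g : ℝ → ℝ → ℝ}
    {g₀ : ℝ → ℝ} {C : ℝ} (hg : ∀ ε > 0, Measurable (g ε)) (hC : ∀ ε > 0, ∀ x, |g ε x| ≤ C)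
    (hlim : ∀ᵐ w, Tendsto (fun ε => g ε w) (𝓝[>] 0) (𝓝 (g₀ w))) :
    Tendsto (fun ε => ∫ w, ρ w * g ε w) (𝓝[>] 0) (𝓝 (∫ w, ρ w * g₀ w)) := by
  refine tendsto_integral_filter_of_dominated_convergence (fun w => ρ w * C) ?_ ?_
    (h.integrable.mul_const C) ?_
  · filter_upwards [self_mem_nhdsWithin] with ε hε
    exact (h.smooth.continuous.measurable.mul (hg ε hε)).aestronglyMeasurable
  · filter_upwards [self_mem_nhdsWithin] with ε hε
    refine Eventually.of_forall fun w => ?_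
    rw [norm_mul, Real.norm_eq_abs, abs_of_nonneg (h.nonneg w)]
    exact mul_le_mul_of_nonneg_left (hC ε hε w) (h.nonneg w)
  · filter_upwards [hlim] with w hw using hw.const_mul _

/-! ### The mollified peakon -/

section Kernel

/-- The mollification of `exp (-|x|)` at scale `ε`. -/
noncomputable def kernel (ρ : ℝ → ℝ) (ε x : ℝ) : ℝ := ∫ w, ρ w * Real.exp (-|x - ε * w|)

/-- The mollification at scale `ε` of the derivative `-sgn x exp (-|x|)` of the peakon. -/
noncomputable def kernelDeriv (ρ : ℝ → ℝ) (ε x : ℝ) : ℝ :=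
  ∫ w, ρ w * (-Real.sign (x - ε * w) * Real.exp (-|x - ε * w|))

/-- The mollification `∫ ρ(w) sgn(z - w) dw` of the sign function, at scale one. It is the inner
profile of the mollified jump of `exp (-|x|)'`. -/
noncomputable def signProfile (ρ : ℝ → ℝ) (z : ℝ) : ℝ := ∫ w, ρ w * Real.sign (z - w)

variable {ρ : ℝ → ℝ}

theorem abs_exp_neg_abs_le (x : ℝ) : |Real.exp (-|x|)| ≤ 1 := by
  rw [Real.abs_exp, Real.exp_le_one_iff]
  simp

theorem abs_sign_mul_exp_le (x : ℝ) : |-Real.sign x * Real.exp (-|x|)| ≤ 1 := by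
  rw [abs_mul, abs_neg]
  exact mul_le_one₀ (abs_sign_le_one x) (abs_nonneg _) (abs_exp_neg_abs_le x)

theorem measurable_exp_neg_abs : Measurable fun x : ℝ => Real.exp (-|x|) :=
  (by fun_prop : Continuous fun x : ℝ => Real.exp (-|x|)).measurable

theorem measurable_sign_mul_exp :
    Measurable fun x : ℝ => -Real.sign x * Real.exp (-|x|) :=
  measurable_sign.neg.mul measurable_exp_neg_abs

theorem abs_kernel_le (h : IsMollifier ρ) (ε x : ℝ) : |kernel ρ ε x| ≤ 1 :=
  h.abs_integral_mul_le fun _ => abs_exp_neg_abs_le _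

theorem abs_kernelDeriv_le (h : IsMollifier ρ) (ε x : ℝ) : |kernelDeriv ρ ε x| ≤ 1 :=
  h.abs_integral_mul_le fun _ => abs_sign_mul_exp_le _

theorem kernel_eq (h : IsMollifier ρ) {ε : ℝ} (hε : 0 < ε) (x : ℝ) :
    kernel ρ ε x = Real.exp (-x) * (∫ w in Iic (x / ε), ρ w * Real.exp (ε * w))
      + Real.exp x * ∫ w in Ioi (x / ε), ρ w * Real.exp (-(ε * w)) := by
  have hi := h.integrable_mul (g := fun w => Real.exp (-|x - ε * w|))
    (measurable_exp_neg_abs.comp (by fun_prop)) (fun _ => abs_exp_neg_abs_le _)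
  rw [kernel, ← intervalIntegral.integral_Iic_add_Ioi (b := x / ε) hi.integrableOn hi.integrableOn,
    ← integral_const_mul, ← integral_const_mul]
  congr 1
  · refine setIntegral_congr_fun measurableSet_Iic fun w hw => ?_
    have : ε * w ≤ x := by rw [mul_comm]; exact (le_div_iff₀ hε).1 hw
    rw [abs_of_nonneg (by linarith), show -(x - ε * w) = -x + ε * w by ring, Real.exp_add]
    ring
  · refine setIntegral_congr_fun measurableSet_Ioi fun w hw => ?_
    have : x < ε * w := by rw [mul_comm]; exact (div_lt_iff₀ hε).1 hw
    rw [abs_of_neg (by linarith), show -(-(x - ε * w)) = x + -(ε * w) by ring, Real.exp_add]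
    ring

theorem kernelDeriv_eq (h : IsMollifier ρ) {ε : ℝ} (hε : 0 < ε) (x : ℝ) :
    kernelDeriv ρ ε x = -(Real.exp (-x) * ∫ w in Iic (x / ε), ρ w * Real.exp (ε * w))
      + Real.exp x * ∫ w in Ioi (x / ε), ρ w * Real.exp (-(ε * w)) := by
  have hi := h.integrable_mul
    (g := fun w => -Real.sign (x - ε * w) * Real.exp (-|x - ε * w|))
    (measurable_sign_mul_exp.comp (by fun_prop)) (fun _ => abs_sign_mul_exp_le _)
  rw [kernelDeriv, ← intervalIntegral.integral_Iic_add_Ioi (b := x / ε) hi.integrableOn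
    hi.integrableOn, ← integral_const_mul, ← integral_const_mul, ← integral_neg]
  congr 1
  · rw [integral_Iic_eq_integral_Iio, integral_Iic_eq_integral_Iio]
    refine setIntegral_congr_fun measurableSet_Iio fun w hw => ?_
    have : ε * w < x := by rw [mul_comm]; exact (lt_div_iff₀ hε).1 hw
    rw [Real.sign_of_pos (by linarith), abs_of_nonneg (by linarith),
      show -(x - ε * w) = -x + ε * w by ring, Real.exp_add]
    ring
  · refine setIntegral_congr_fun measurableSet_Ioi fun w hw => ?_
    have : x < ε * w := by rw [mul_comm]; exact (div_lt_iff₀ hε).1 hw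
    rw [Real.sign_of_neg (by linarith), abs_of_neg (by linarith),
      show -(-(x - ε * w)) = x + -(ε * w) by ring, Real.exp_add]
    ring

theorem hasDerivAt_kernel_left (h : IsMollifier ρ) {ε : ℝ} (hε : 0 < ε) (x : ℝ) :
    HasDerivAt (fun x => Real.exp (-x) * ∫ w in Iic (x / ε), ρ w * Real.exp (ε * w))
      (-(Real.exp (-x) * ∫ w in Iic (x / ε), ρ w * Real.exp (ε * w)) + ε⁻¹ * ρ (x / ε)) x := by
  have h1 : HasDerivAt (fun x : ℝ => x / ε) ε⁻¹ x := by
    simpa using (hasDerivAt_id x).div_const ε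
  have h2 := (hasDerivAt_integral_Iic (h.smooth.continuous.mul (by fun_prop))
    (h.integrable_mul_continuous (g := fun w => Real.exp (ε * w)) (by fun_prop)) (x / ε)).comp x h1
  have h3 : HasDerivAt (fun x : ℝ => Real.exp (-x)) (-Real.exp (-x)) x := by
    simpa using (hasDerivAt_neg x).exp
  refine (h3.mul h2).congr_deriv ?_
  have : Real.exp (-x) * Real.exp x = 1 := by rw [← Real.exp_add]; simp
  simp only [Function.comp, Pi.mul_apply, mul_div_cancel₀ x hε.ne']
  linear_combination ε⁻¹ * ρ (x / ε) * this

theorem hasDerivAt_kernel_right (h : IsMollifier ρ) {ε : ℝ} (hε : 0 < ε) (x : ℝ) :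
    HasDerivAt (fun x => Real.exp x * ∫ w in Ioi (x / ε), ρ w * Real.exp (-(ε * w)))
      (Real.exp x * (∫ w in Ioi (x / ε), ρ w * Real.exp (-(ε * w))) - ε⁻¹ * ρ (x / ε)) x := by
  have h1 : HasDerivAt (fun x : ℝ => x / ε) ε⁻¹ x := by
    simpa using (hasDerivAt_id x).div_const ε
  have h2 := (hasDerivAt_integral_Ioi (h.smooth.continuous.mul (by fun_prop))
    (h.integrable_mul_continuous (g := fun w => Real.exp (-(ε * w))) (by fun_prop))
    (x / ε)).comp x h1
  refine ((Real.hasDerivAt_exp x).mul h2).congr_deriv ?_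
  have : Real.exp x * Real.exp (-x) = 1 := by rw [← Real.exp_add]; simp
  simp only [Function.comp, Pi.mul_apply, mul_div_cancel₀ x hε.ne']
  linear_combination -ε⁻¹ * ρ (x / ε) * this

theorem hasDerivAt_kernel (h : IsMollifier ρ) {ε : ℝ} (hε : 0 < ε) (x : ℝ) :
    HasDerivAt (kernel ρ ε) (kernelDeriv ρ ε x) x := by
  rw [funext (kernel_eq h hε), kernelDeriv_eq h hε]
  refine ((hasDerivAt_kernel_left h hε x).add (hasDerivAt_kernel_right h hε x)).congr_deriv ?_
  ring

/-- The peakon is twice the fundamental solution of `1 - ∂ₓ²`, here in mollified form. -/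
theorem hasDerivAt_kernelDeriv (h : IsMollifier ρ) {ε : ℝ} (hε : 0 < ε) (x : ℝ) :
    HasDerivAt (kernelDeriv ρ ε) (kernel ρ ε x - 2 * (ε⁻¹ * ρ (x / ε))) x := by
  rw [funext (kernelDeriv_eq h hε), kernel_eq h hε]
  refine ((hasDerivAt_kernel_left h hε x).neg.add
    (hasDerivAt_kernel_right h hε x)).congr_deriv ?_
  ring

theorem continuous_kernel (h : IsMollifier ρ) {ε : ℝ} (hε : 0 < ε) : Continuous (kernel ρ ε) :=
  continuous_iff_continuousAt.2 fun x => (hasDerivAt_kernel h hε x).continuousAt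

theorem continuous_kernelDeriv (h : IsMollifier ρ) {ε : ℝ} (hε : 0 < ε) :
    Continuous (kernelDeriv ρ ε) :=
  continuous_iff_continuousAt.2 fun x => (hasDerivAt_kernelDeriv h hε x).continuousAt

theorem tendsto_add_mul_nhdsGT_zero (d z w : ℝ) :
    Tendsto (fun ε : ℝ => d + ε * z - ε * w) (𝓝[>] 0) (𝓝 d) := by
  have : Continuous fun ε : ℝ => d + ε * z - ε * w := by fun_prop
  simpa using (this.tendsto 0).mono_left nhdsWithin_le_nhds

theorem tendsto_kernel (h : IsMollifier ρ) (d z : ℝ) :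
    Tendsto (fun ε => kernel ρ ε (d + ε * z)) (𝓝[>] 0) (𝓝 (Real.exp (-|d|))) := by
  have := h.tendsto_integral_mul (g := fun ε w => Real.exp (-|d + ε * z - ε * w|))
    (g₀ := fun _ => Real.exp (-|d|)) (C := 1)
    (fun ε _ => measurable_exp_neg_abs.comp (by fun_prop)) (fun ε _ w => abs_exp_neg_abs_le _)
    (Eventually.of_forall fun w =>
      ((by fun_prop : Continuous fun x : ℝ => Real.exp (-|x|)).tendsto d).comp
        (tendsto_add_mul_nhdsGT_zero d z w))
  simpa [integral_mul_const, h.integral_eq_one, kernel] using this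

/-- Near a peak of its own, the derivative of the mollified peakon has the profile
`-signProfile ρ`. A peak at a distance `d ≠ 0` contributes the
ordinary derivative. -/
theorem tendsto_kernelDeriv (h : IsMollifier ρ) (d z : ℝ) :
    Tendsto (fun ε => kernelDeriv ρ ε (d + ε * z)) (𝓝[>] 0)
      (𝓝 (-Real.sign d * Real.exp (-|d|) - if d = 0 then signProfile ρ z else 0)) := by
  have hm : ∀ ε > (0 : ℝ), Measurable fun w : ℝ =>
      -Real.sign (d + ε * z - ε * w) * Real.exp (-|d + ε * z - ε * w|) :=
    fun ε _ => measurable_sign_mul_exp.comp (by fun_prop)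
  by_cases hd : d = 0
  · subst hd
    have := h.tendsto_integral_mul
      (g := fun ε w => -Real.sign (0 + ε * z - ε * w) * Real.exp (-|0 + ε * z - ε * w|))
      (g₀ := fun w => -Real.sign (z - w)) (C := 1) hm
      (fun ε _ w => abs_sign_mul_exp_le _) (Eventually.of_forall fun w => ?_)
    · simpa [kernelDeriv, signProfile, integral_neg] using this
    · have h1 : Tendsto (fun ε : ℝ => -Real.sign (z - w) * Real.exp (-|0 + ε * z - ε * w|))
          (𝓝[>] 0) (𝓝 (-Real.sign (z - w) * Real.exp (-|0|))) :=
        (((by fun_prop : Continuous fun x : ℝ => Real.exp (-|x|)).tendsto 0).comp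
          (tendsto_add_mul_nhdsGT_zero 0 z w)).const_mul _
      simp only [abs_zero, neg_zero, Real.exp_zero, mul_one] at h1
      refine h1.congr' ?_
      filter_upwards [self_mem_nhdsWithin] with ε hε
      have hε : 0 < ε := hε
      have : Real.sign (0 + ε * z - ε * w) = Real.sign (z - w) := by
        rw [show 0 + ε * z - ε * w = ε * (z - w) by ring]
        rcases lt_trichotomy (z - w) 0 with hh | hh | hh
        · rw [Real.sign_of_neg hh, Real.sign_of_neg (mul_neg_of_pos_of_neg hε hh)]
        · simp [hh]
        · rw [Real.sign_of_pos hh, Real.sign_of_pos (mul_pos hε hh)]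
      rw [this]
  · have hc : ContinuousAt (fun x : ℝ => -Real.sign x * Real.exp (-|x|)) d :=
      (continuousAt_sign hd).neg.mul (by fun_prop)
    have := h.tendsto_integral_mul
      (g := fun ε w => -Real.sign (d + ε * z - ε * w) * Real.exp (-|d + ε * z - ε * w|))
      (g₀ := fun _ => -Real.sign d * Real.exp (-|d|)) (C := 1) hm
      (fun ε _ w => abs_sign_mul_exp_le _) (Eventually.of_forall fun w =>
        hc.tendsto.comp (tendsto_add_mul_nhdsGT_zero d z w))
    simpa [integral_mul_const, h.integral_eq_one, hd, kernelDeriv, integral_neg] using this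

theorem signProfile_eq (h : IsMollifier ρ) (z : ℝ) :
    signProfile ρ z = 2 * (∫ w in Iic z, ρ w) - 1 := by
  have hi := h.integrable_mul (g := fun w => Real.sign (z - w))
    (measurable_sign.comp (by fun_prop)) (fun _ => abs_sign_le_one _)
  have h1 : ∫ w in Iic z, ρ w * Real.sign (z - w) = ∫ w in Iic z, ρ w := by
    rw [integral_Iic_eq_integral_Iio, integral_Iic_eq_integral_Iio]
    refine setIntegral_congr_fun measurableSet_Iio fun w hw => ?_
    rw [Real.sign_of_pos (sub_pos.2 hw), mul_one]
  have h2 : ∫ w in Ioi z, ρ w * Real.sign (z - w) = -∫ w in Ioi z, ρ w := by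
    rw [← integral_neg]
    refine setIntegral_congr_fun measurableSet_Ioi fun w hw => ?_
    rw [Real.sign_of_neg (sub_neg.2 hw), mul_neg_one]
  rw [signProfile, ← intervalIntegral.integral_Iic_add_Ioi (b := z) hi.integrableOn
    hi.integrableOn, h1, h2, integral_Ioi_eq_sub h.integrable, h.integral_eq_one]
  ring

theorem hasDerivAt_signProfile (h : IsMollifier ρ) (z : ℝ) :
    HasDerivAt (signProfile ρ) (2 * ρ z) z := by
  rw [funext (signProfile_eq h)]
  exact ((hasDerivAt_integral_Iic h.smooth.continuous h.integrable z).const_mul 2).sub_const 1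

theorem continuous_signProfile (h : IsMollifier ρ) : Continuous (signProfile ρ) :=
  continuous_iff_continuousAt.2 fun x => (hasDerivAt_signProfile h x).continuousAt

theorem tendsto_signProfile_atTop (h : IsMollifier ρ) :
    Tendsto (signProfile ρ) atTop (𝓝 1) := by
  have h1 : Tendsto (fun z => ∫ w in Iic z, ρ w) atTop (𝓝 (∫ w, ρ w)) :=
    (aecover_Iic tendsto_id).integral_tendsto_of_countably_generated h.integrable
  rw [h.integral_eq_one] at h1
  rw [funext (signProfile_eq h)]
  convert (h1.const_mul 2).sub_const 1 using 2
  norm_num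

theorem tendsto_signProfile_atBot (h : IsMollifier ρ) :
    Tendsto (signProfile ρ) atBot (𝓝 (-1)) := by
  have h1 : Tendsto (fun z => ∫ w in Ioi z, ρ w) atBot (𝓝 (∫ w, ρ w)) :=
    (aecover_Ioi tendsto_id).integral_tendsto_of_countably_generated h.integrable
  have h2 : (fun z => ∫ w in Iic z, ρ w) = fun z => 1 - ∫ w in Ioi z, ρ w := by
    funext z
    rw [integral_Ioi_eq_sub h.integrable, h.integral_eq_one]
    ring
  rw [h.integral_eq_one] at h1
  simp_rw [funext (signProfile_eq h), funext_iff.1 h2]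
  convert ((h1.const_sub 1).const_mul 2).sub_const 1 using 2
  norm_num

theorem integral_mul_signProfile_pow (h : IsMollifier ρ) (n : ℕ) :
    ∫ z, ρ z * signProfile ρ z ^ n = (1 - (-1) ^ (n + 1)) / (2 * (n + 1)) := by
  have hn : (2 * ((n : ℝ) + 1)) ≠ 0 := by positivity
  have hd : ∀ z, HasDerivAt (fun z => signProfile ρ z ^ (n + 1) / (2 * ((n : ℝ) + 1)))
      (ρ z * signProfile ρ z ^ n) z := fun z => by
    refine (((hasDerivAt_signProfile h z).pow (n + 1)).div_const _).congr_deriv ?_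
    push_cast
    field_simp
  rw [integral_of_hasDerivAt_of_tendsto hd
    (h.integrable_mul_continuous ((continuous_signProfile h).pow n))
    (((tendsto_signProfile_atBot h).pow (n + 1)).div_const _)
    (((tendsto_signProfile_atTop h).pow (n + 1)).div_const _)]
  rw [one_pow, ← sub_div]

/-- The mollified jump has mean zero at its own peak, whether or not `ρ` is even. -/
theorem integral_mul_signProfile (h : IsMollifier ρ) : ∫ z, ρ z * signProfile ρ z = 0 := by
  simpa using integral_mul_signProfile_pow h 1

/-- The constant `1/3` is independent of `ρ`. It is the source of the self-interaction term
`(1/6) (pⱼ² + rⱼ sⱼ)` of the peakon equations. -/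
theorem integral_mul_signProfile_sq (h : IsMollifier ρ) :
    ∫ z, ρ z * signProfile ρ z ^ 2 = 1 / 3 := by
  rw [integral_mul_signProfile_pow h 2]
  norm_num

end Kernel

/-! ### Test functions on the strip -/

section TestFunctions

theorem continuous_of_continuousOn_of_eq_zero {f : ℝ → ℝ} {I K : Set ℝ} (hI : IsOpen I)
    (hK : IsClosed K) (hKI : K ⊆ I) (hf : ContinuousOn f I) (h0 : ∀ t ∉ K, f t = 0) :
    Continuous f := by
  refine continuous_iff_continuousAt.2 fun t => ?_
  by_cases ht : t ∈ K
  · exact hf.continuousAt (hI.mem_nhds (hKI ht))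
  · refine (continuousAt_const (y := (0 : ℝ))).congr ?_
    filter_upwards [hK.isOpen_compl.mem_nhds ht] with τ hτ using (h0 τ hτ).symm

theorem integrable_of_continuousOn_of_eq_zero {f : ℝ → ℝ} {I K : Set ℝ} (hI : IsOpen I)
    (hK : IsCompact K) (hKI : K ⊆ I) (hf : ContinuousOn f I) (h0 : ∀ t ∉ K, f t = 0) :
    Integrable f :=
  (continuous_of_continuousOn_of_eq_zero hI hK.isClosed hKI hf h0).integrable_of_hasCompactSupport
    (HasCompactSupport.intro hK h0)

variable {I : Set ℝ} {φ : Field2}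

namespace IsTestFunction

theorem exists_compact (h : IsTestFunction I φ) : ∃ K K' : Set ℝ, IsCompact K ∧ IsCompact K' ∧
    K ⊆ I ∧ (∀ t ∉ K, ∀ x, φ t x = 0) ∧ ∀ t, ∀ x ∉ K', φ t x = 0 := by
  have h0 : ∀ t x, (t, x) ∉ tsupport (Function.uncurry φ) → φ t x = 0 := fun t x hh =>
    image_eq_zero_of_notMem_tsupport (f := Function.uncurry φ) hh
  refine ⟨Prod.fst '' tsupport (Function.uncurry φ), Prod.snd '' tsupport (Function.uncurry φ),
    h.compact.isCompact.image continuous_fst, h.compact.isCompact.image continuous_snd, ?_, ?_, ?_⟩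
  · rintro _ ⟨z, hz, rfl⟩
    exact (h.support_subset hz).1
  · exact fun t ht x => h0 t x fun hh => ht ⟨_, hh, rfl⟩
  · exact fun t x hx => h0 t x fun hh => hx ⟨_, hh, rfl⟩

theorem continuous (h : IsTestFunction I φ) : Continuous (Function.uncurry φ) :=
  h.smooth.continuous

theorem exists_bound (h : IsTestFunction I φ) : ∃ C, ∀ t x, |φ t x| ≤ C :=
  (h.continuous.bounded_above_of_compact_support h.compact).imp fun _ hC t x => hC (t, x)

theorem hasFDerivAt (h : IsTestFunction I φ) (z : ℝ × ℝ) :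
    HasFDerivAt (Function.uncurry φ) (fderiv ℝ (Function.uncurry φ) z) z :=
  (h.smooth.differentiable (by simp) z).hasFDerivAt

theorem hasDerivAt_comp (h : IsTestFunction I φ) {α β : ℝ → ℝ} {α' β' t : ℝ}
    (hα : HasDerivAt α α' t) (hβ : HasDerivAt β β' t) :
    HasDerivAt (fun τ => φ (α τ) (β τ))
      (fderiv ℝ (Function.uncurry φ) (α t, β t) (α', β')) t :=
  HasFDerivAt.comp_hasDerivAt (f := fun τ => (α τ, β τ)) t (h.hasFDerivAt (α t, β t))
    (hα.prodMk hβ)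

theorem dx_eq (h : IsTestFunction I φ) (t x : ℝ) :
    dx φ t x = fderiv ℝ (Function.uncurry φ) (t, x) (0, 1) :=
  (h.hasDerivAt_comp (hasDerivAt_const x t) (hasDerivAt_id x)).deriv

theorem dt_eq (h : IsTestFunction I φ) (t x : ℝ) :
    dt φ t x = fderiv ℝ (Function.uncurry φ) (t, x) (1, 0) :=
  (h.hasDerivAt_comp (hasDerivAt_id t) (hasDerivAt_const t x)).deriv

theorem hasDerivAt_along (h : IsTestFunction I φ) {q : ℝ → ℝ} {q' t : ℝ}
    (hq : HasDerivAt q q' t) :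
    HasDerivAt (fun τ => φ τ (q τ)) (dt φ t (q t) + q' * dx φ t (q t)) t := by
  refine (h.hasDerivAt_comp (hasDerivAt_id t) hq).congr_deriv ?_
  rw [h.dt_eq, h.dx_eq, ← smul_eq_mul, ← map_smul, ← map_add]
  simp

theorem of_fderiv (h : IsTestFunction I φ) (v : ℝ × ℝ) {ψ : Field2}
    (hψ : ∀ t x, ψ t x = fderiv ℝ (Function.uncurry φ) (t, x) v) : IsTestFunction I ψ := by
  have he : Function.uncurry ψ = fun z => fderiv ℝ (Function.uncurry φ) z v := by
    funext ⟨t, x⟩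
    exact hψ t x
  have hs : tsupport (Function.uncurry ψ) ⊆ tsupport (Function.uncurry φ) :=
    he ▸ tsupport_fderiv_apply_subset ℝ v
  refine ⟨?_, h.compact.of_isClosed_subset (isClosed_tsupport _) hs, hs.trans h.support_subset⟩
  rw [he]
  exact (h.smooth.fderiv_right (m := ∞) (by simp)).clm_apply contDiff_const

theorem dx (h : IsTestFunction I φ) : IsTestFunction I (dx φ) := h.of_fderiv (0, 1) h.dx_eq

theorem dt (h : IsTestFunction I φ) : IsTestFunction I (dt φ) := h.of_fderiv (1, 0) h.dt_eq

theorem hasCompactSupport_slice (h : IsTestFunction I φ) (t : ℝ) : HasCompactSupport (φ t) := by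
  obtain ⟨K, K', -, hK', -, -, h0⟩ := h.exists_compact
  exact HasCompactSupport.intro hK' (h0 t)

theorem contDiff_slice (h : IsTestFunction I φ) (t : ℝ) : ContDiff ℝ ∞ (φ t) :=
  h.smooth.comp (contDiff_const.prodMk contDiff_id)

theorem continuousOn_along (h : IsTestFunction I φ) {J : Set ℝ} {q : ℝ → ℝ}
    (hq : ContinuousOn q J) : ContinuousOn (fun t => φ t (q t)) J :=
  h.continuous.comp_continuousOn (continuousOn_id.prodMk hq)

theorem integrable_mul_along (h : IsTestFunction I φ) (hI : IsOpen I) {a q : ℝ → ℝ}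
    (ha : ContinuousOn a I) (hq : ContinuousOn q I) :
    Integrable (fun t => a t * φ t (q t)) := by
  obtain ⟨K, K', hK, -, hKI, h0, -⟩ := h.exists_compact
  refine integrable_of_continuousOn_of_eq_zero hI hK hKI (ha.mul (h.continuousOn_along hq)) ?_
  intro t ht
  rw [h0 t ht, mul_zero]

end IsTestFunction

/-- The peakon is twice the fundamental solution of `1 - ∂ₓ²`. -/
theorem integral_exp_neg_abs_mul_sub {ψ : ℝ → ℝ} (hψ : ContDiff ℝ ∞ ψ) (hc : HasCompactSupport ψ)
    (q : ℝ) : ∫ x, Real.exp (-|x - q|) * (ψ x - deriv (deriv ψ) x) = 2 * ψ q := by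
  have hψ' : ContDiff ℝ ∞ (deriv ψ) := ((contDiff_infty_iff_deriv (𝕜 := ℝ)).1 hψ).2
  have hψ'' : ContDiff ℝ ∞ (deriv (deriv ψ)) := ((contDiff_infty_iff_deriv (𝕜 := ℝ)).1 hψ').2
  have hd : ∀ x, HasDerivAt ψ (deriv ψ x) x := fun x =>
    (hψ.differentiable (by simp) x).hasDerivAt
  have hd' : ∀ x, HasDerivAt (deriv ψ) (deriv (deriv ψ) x) x := fun x =>
    (hψ'.differentiable (by simp) x).hasDerivAt
  have hi : Integrable fun x => Real.exp (-|x - q|) * (ψ x - deriv (deriv ψ) x) :=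
    Continuous.integrable_of_hasCompactSupport
      ((by fun_prop : Continuous fun x => Real.exp (-|x - q|)).mul
        (hψ.continuous.sub hψ''.continuous)) ((hc.sub hc.deriv.deriv).mul_left)
  have hl : ∀ x, HasDerivAt (fun x => Real.exp (x - q) * (ψ x - deriv ψ x))
      (Real.exp (x - q) * (ψ x - deriv (deriv ψ) x)) x := fun x => by
    refine ((((hasDerivAt_id x).sub_const q).exp).mul ((hd x).sub (hd' x))).congr_deriv ?_
    simp only [id, Pi.sub_apply]
    ring
  have hr : ∀ x, HasDerivAt (fun x => -Real.exp (-(x - q)) * (ψ x + deriv ψ x))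
      (Real.exp (-(x - q)) * (ψ x - deriv (deriv ψ) x)) x := fun x => by
    refine ((((hasDerivAt_id x).sub_const q).neg.exp).neg.mul ((hd x).add (hd' x))).congr_deriv ?_
    simp only [id, Pi.add_apply, Pi.neg_apply]
    ring
  have h1 : ∫ x in Iic q, Real.exp (-|x - q|) * (ψ x - deriv (deriv ψ) x) = ψ q - deriv ψ q := by
    have := HasCompactSupport.integral_Iic_deriv_eq
      (f := fun x => Real.exp (x - q) * (ψ x - deriv ψ x))
      (ContDiff.of_le (n := ∞) (by fun_prop) (by simp)) ((hc.sub hc.deriv).mul_left) q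
    simp only [sub_self, Real.exp_zero, one_mul] at this
    rw [← this]
    refine setIntegral_congr_fun measurableSet_Iic fun x hx => ?_
    rw [(hl x).deriv, abs_of_nonpos (sub_nonpos.2 hx), neg_neg]
  have h2 : ∫ x in Ioi q, Real.exp (-|x - q|) * (ψ x - deriv (deriv ψ) x) = ψ q + deriv ψ q := by
    have := HasCompactSupport.integral_Ioi_deriv_eq
      (f := fun x => -Real.exp (-(x - q)) * (ψ x + deriv ψ x))
      (ContDiff.of_le (n := ∞) (by fun_prop) (by simp)) ((hc.add hc.deriv).mul_left) q
    simp only [sub_self, neg_zero, Real.exp_zero, neg_mul, one_mul, neg_neg] at this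
    rw [← this]
    refine setIntegral_congr_fun measurableSet_Ioi fun x hx => ?_
    have hx : q < x := hx
    have := (hr x).deriv
    simp only [neg_mul] at this
    rw [this, abs_of_pos (sub_pos.2 hx)]
  rw [← intervalIntegral.integral_Iic_add_Ioi (b := q) hi.integrableOn hi.integrableOn, h1, h2]
  ring

variable {N : ℕ} {a b c q : Fin N → ℝ → ℝ}

theorem integral_peakons_mul_momentum (h : IsTestFunction I φ) (t : ℝ) :
    ∫ x, peakons a q t x * momentum φ t x = ∑ j, 2 * a j t * φ t (q j t) := by
  have hc : Continuous fun x => φ t x - deriv (deriv (φ t)) x :=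
    (h.contDiff_slice t).continuous.sub (h.dx.dx.contDiff_slice t).continuous
  have hs : HasCompactSupport fun x => φ t x - deriv (deriv (φ t)) x :=
    (h.hasCompactSupport_slice t).sub (h.hasCompactSupport_slice t).deriv.deriv
  have : ∀ x, peakons a q t x * momentum φ t x
      = ∑ j, a j t * (Real.exp (-|x - q j t|) * (φ t x - deriv (deriv (φ t)) x)) := fun x => by
    rw [peakons, Finset.sum_mul]
    exact Finset.sum_congr rfl fun j _ => mul_assoc _ _ _
  simp_rw [this]
  rw [integral_finsetSum]
  · refine Finset.sum_congr rfl fun j _ => ?_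
    rw [integral_const_mul,
      integral_exp_neg_abs_mul_sub (h.contDiff_slice t) (h.hasCompactSupport_slice t)]
    ring
  · intro j _
    exact (Continuous.integrable_of_hasCompactSupport
      ((by fun_prop : Continuous fun x => Real.exp (-|x - q j t|)).mul hc) hs.mul_left).const_mul _

end TestFunctions

/-! ### Mollified multipeakons -/

section Mollified

variable {N : ℕ} {a b c q : Fin N → ℝ → ℝ} {ρ : ℝ → ℝ} {ε : ℝ} {I : Set ℝ}

theorem mollify_peakons (h : IsMollifier ρ) (hε : 0 < ε) (t x : ℝ) :
    mollify ρ ε (peakons a q) t x = ∑ j, a j t * kernel ρ ε (x - q j t) := by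
  have hk : ∀ j, ∫ y, ε⁻¹ * (ρ ((x - y) / ε) * Real.exp (-|y - q j t|))
      = kernel ρ ε (x - q j t) := fun j => by
    have h1 := integral_sub_left_eq_self
      (fun y => ρ (y / ε) * Real.exp (-|x - q j t - ε * (y / ε)|)) volume x
    rw [Measure.integral_comp_div (fun y => ρ y * Real.exp (-|x - q j t - ε * y|)) ε,
      abs_of_pos hε, smul_eq_mul] at h1
    rw [integral_const_mul, kernel, eq_comm, ← inv_mul_cancel_left₀ hε.ne'
      (∫ w, ρ w * Real.exp (-|x - q j t - ε * w|)), ← h1]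
    congr 1
    refine integral_congr_ae (Eventually.of_forall fun y => ?_)
    simp only []
    rw [mul_div_cancel₀ _ hε.ne']
    ring_nf
  have hi : ∀ j, Integrable fun y => ε⁻¹ * (ρ ((x - y) / ε) * Real.exp (-|y - q j t|)) :=
    fun j => by
      refine (Integrable.mul_bdd (c := 1) ?_ ?_ (Eventually.of_forall fun y =>
        abs_exp_neg_abs_le _)).const_mul _
      · exact (h.integrable.comp_div hε.ne').comp_sub_left x
      · exact (by fun_prop : Continuous fun y => Real.exp (-|y - q j t|)).aestronglyMeasurable
  simp_rw [mollify, peakons, Finset.mul_sum]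
  have he : ∀ j y, ε⁻¹ * ρ ((x - y) / ε) * (a j t * Real.exp (-|y - q j t|))
      = a j t * (ε⁻¹ * (ρ ((x - y) / ε) * Real.exp (-|y - q j t|))) := fun j y => by ring
  simp_rw [he]
  rw [integral_finsetSum _ fun j _ => (hi j).const_mul _]
  exact Finset.sum_congr rfl fun j _ => by rw [integral_const_mul, hk]

theorem hasDerivAt_sum_comp_sub {k k' : ℝ → ℝ} (hk : ∀ x, HasDerivAt k (k' x) x) (t x : ℝ) :
    HasDerivAt (fun x => ∑ j, a j t * k (x - q j t)) (∑ j, a j t * k' (x - q j t)) x :=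
  HasDerivAt.fun_sum fun j _ => by
    simpa using ((hk (x - q j t)).comp x ((hasDerivAt_id x).sub_const (q j t))).const_mul (a j t)

theorem dx_mollify_peakons (h : IsMollifier ρ) (hε : 0 < ε) (t x : ℝ) :
    dx (mollify ρ ε (peakons a q)) t x = ∑ j, a j t * kernelDeriv ρ ε (x - q j t) := by
  simp_rw [dx, mollify_peakons h hε]
  exact (hasDerivAt_sum_comp_sub (hasDerivAt_kernel h hε) t x).deriv

theorem momentum_mollify_peakons (h : IsMollifier ρ) (hε : 0 < ε) (t x : ℝ) :
    momentum (mollify ρ ε (peakons a q)) t x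
      = ∑ j, 2 * a j t * (ε⁻¹ * ρ ((x - q j t) / ε)) := by
  have : dx (dx (mollify ρ ε (peakons a q))) t x = ∑ j, a j t *
      (kernel ρ ε (x - q j t) - 2 * (ε⁻¹ * ρ ((x - q j t) / ε))) := by
    rw [dx]
    simp_rw [dx_mollify_peakons h hε]
    exact (hasDerivAt_sum_comp_sub (hasDerivAt_kernelDeriv h hε) t x).deriv
  rw [momentum, this, mollify_peakons h hε, ← Finset.sum_sub_distrib]
  exact Finset.sum_congr rfl fun j _ => by ring

theorem continuousOn_sum_comp_sub {k : ℝ → ℝ} (hk : Continuous k)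
    (ha : ∀ j, ContinuousOn (a j) I) (hq : ∀ j, ContinuousOn (q j) I) :
    ContinuousOn (fun z : ℝ × ℝ => ∑ j, a j z.1 * k (z.2 - q j z.1)) (I ×ˢ univ) := by
  refine continuousOn_finsetSum _ fun j _ => ?_
  have h1 : MapsTo Prod.fst (I ×ˢ (univ : Set ℝ)) I := fun z hz => hz.1
  exact ((ha j).comp continuousOn_fst h1).mul
    (hk.comp_continuousOn (continuousOn_snd.sub ((hq j).comp continuousOn_fst h1)))

theorem continuousOn_mollify_peakons (h : IsMollifier ρ) (hε : 0 < ε)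
    (ha : ∀ j, ContinuousOn (a j) I) (hq : ∀ j, ContinuousOn (q j) I) :
    ContinuousOn (Function.uncurry (mollify ρ ε (peakons a q))) (I ×ˢ univ) :=
  (continuousOn_sum_comp_sub (continuous_kernel h hε) ha hq).congr fun z _ =>
    mollify_peakons h hε z.1 z.2

theorem continuousOn_dx_mollify_peakons (h : IsMollifier ρ) (hε : 0 < ε)
    (ha : ∀ j, ContinuousOn (a j) I) (hq : ∀ j, ContinuousOn (q j) I) :
    ContinuousOn (Function.uncurry (dx (mollify ρ ε (peakons a q)))) (I ×ˢ univ) :=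
  (continuousOn_sum_comp_sub (continuous_kernelDeriv h hε) ha hq).congr fun z _ =>
    dx_mollify_peakons h hε z.1 z.2

theorem continuousOn_momentum_mollify_peakons (h : IsMollifier ρ) (hε : 0 < ε)
    (ha : ∀ j, ContinuousOn (a j) I) (hq : ∀ j, ContinuousOn (q j) I) :
    ContinuousOn (Function.uncurry (momentum (mollify ρ ε (peakons a q)))) (I ×ˢ univ) :=
  (continuousOn_sum_comp_sub (a := fun j t => 2 * a j t) (k := fun x => ε⁻¹ * ρ (x / ε))
    (by have := h.smooth.continuous; fun_prop) (fun j => (ha j).const_mul 2) hq).congr fun z _ =>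
    momentum_mollify_peakons h hε z.1 z.2

theorem abs_sum_mul_le {k : Fin N → ℝ} (hk : ∀ j, |k j| ≤ 1) {t M : ℝ}
    (hM : ∑ j, |a j t| ≤ M) : |∑ j, a j t * k j| ≤ M := by
  refine (Finset.abs_sum_le_sum_abs _ _).trans (le_trans (Finset.sum_le_sum fun j _ => ?_) hM)
  rw [abs_mul]
  exact mul_le_of_le_one_right (abs_nonneg _) (hk j)

theorem exists_sum_abs_le (ha : ∀ j, ContinuousOn (a j) I) {K : Set ℝ} (hK : IsCompact K)
    (hKI : K ⊆ I) : ∃ M, 0 ≤ M ∧ ∀ t ∈ K, ∑ j, |a j t| ≤ M := by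
  obtain ⟨M, hM⟩ := hK.exists_bound_of_continuousOn (f := fun t => ∑ j, |a j t|)
    (continuousOn_finsetSum _ fun j _ => ((ha j).mono hKI).abs)
  exact ⟨max M 0, le_max_right _ _, fun t ht =>
    (le_abs_self _).trans ((hM t ht).trans (le_max_left _ _))⟩

/-- The value at `qⱼ` of the space derivative of the multipeakon, with the convention `sgn 0 = 0`,
that is, the average of its one-sided derivatives there. -/
noncomputable def slope (a q : Fin N → ℝ → ℝ) (j : Fin N) (t : ℝ) : ℝ :=
  -∑ i, a i t * (Real.sign (q j t - q i t) * Real.exp (-|q j t - q i t|))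

theorem tendsto_mollify_peakons (h : IsMollifier ρ) (t x z : ℝ) :
    Tendsto (fun ε => mollify ρ ε (peakons a q) t (x + ε * z)) (𝓝[>] 0)
      (𝓝 (peakons a q t x)) := by
  have : Tendsto (fun ε => ∑ j, a j t * kernel ρ ε (x - q j t + ε * z)) (𝓝[>] 0)
      (𝓝 (peakons a q t x)) :=
    tendsto_finsetSum _ fun j _ => (tendsto_kernel h (x - q j t) z).const_mul _
  refine this.congr' ?_
  filter_upwards [self_mem_nhdsWithin] with ε hε
  rw [mollify_peakons h hε]
  exact Finset.sum_congr rfl fun j _ => by ring_nf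

theorem tendsto_dx_mollify_peakons (h : IsMollifier ρ) {t : ℝ} (ht : t ∈ regularTimes I q)
    (j : Fin N) (z : ℝ) :
    Tendsto (fun ε => dx (mollify ρ ε (peakons a q)) t (q j t + ε * z)) (𝓝[>] 0)
      (𝓝 (slope a q j t - a j t * signProfile ρ z)) := by
  have h1 : Tendsto (fun ε => ∑ i, a i t * kernelDeriv ρ ε (q j t - q i t + ε * z)) (𝓝[>] 0)
      (𝓝 (∑ i, a i t * (-Real.sign (q j t - q i t) * Real.exp (-|q j t - q i t|)
        - if q j t - q i t = 0 then signProfile ρ z else 0))) :=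
    tendsto_finsetSum _ fun i _ => (tendsto_kernelDeriv h (q j t - q i t) z).const_mul _
  have h2 : ∀ i, (q j t - q i t = 0) ↔ j = i := fun i =>
    ⟨fun hh => by_contra fun hn => ht.2 j i hn (sub_eq_zero.1 hh), fun hh => by simp [hh]⟩
  have h3 : ∑ i, a i t * (-Real.sign (q j t - q i t) * Real.exp (-|q j t - q i t|)
        - if q j t - q i t = 0 then signProfile ρ z else 0)
      = slope a q j t - a j t * signProfile ρ z := by
    simp_rw [h2, mul_sub, Finset.sum_sub_distrib, mul_ite, mul_zero]
    simp [slope]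
  rw [h3] at h1
  refine h1.congr' ?_
  filter_upwards [self_mem_nhdsWithin] with ε hε
  rw [dx_mollify_peakons h hε]
  exact Finset.sum_congr rfl fun j _ => by ring_nf

end Mollified

/-! ### Limits of space-time integrals -/

section Limits

/-- The iterated integrals of `J ε` over space-time are absolutely convergent for `ε > 0`, and
converge, as `ε ↓ 0`, to the integral of the integrable function `L` of time. -/
structure ConvergesTo (J : ℝ → Field2) (L : ℝ → ℝ) : Prop where
  inner : ∀ ε > 0, ∀ t, Integrable (J ε t)
  outer : ∀ ε > 0, Integrable fun t => ∫ x, J ε t x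
  integrable : Integrable L
  tendsto : Tendsto (fun ε => ∫ t, ∫ x, J ε t x) (𝓝[>] 0) (𝓝 (∫ t, L t))

namespace ConvergesTo

variable {J J' : ℝ → Field2} {L L' : ℝ → ℝ}

theorem add (h : ConvergesTo J L) (h' : ConvergesTo J' L') :
    ConvergesTo (fun ε t x => J ε t x + J' ε t x) (fun t => L t + L' t) where
  inner ε hε t := (h.inner ε hε t).add (h'.inner ε hε t)
  outer ε hε := by
    simp_rw [fun t => integral_add (h.inner ε hε t) (h'.inner ε hε t)]
    exact (h.outer ε hε).add (h'.outer ε hε)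
  integrable := h.integrable.add h'.integrable
  tendsto := by
    rw [integral_add h.integrable h'.integrable]
    refine (h.tendsto.add h'.tendsto).congr' ?_
    filter_upwards [self_mem_nhdsWithin] with ε hε
    simp_rw [fun t => integral_add (h.inner ε hε t) (h'.inner ε hε t)]
    rw [integral_add (h.outer ε hε) (h'.outer ε hε)]

theorem const_mul (h : ConvergesTo J L) (k : ℝ) :
    ConvergesTo (fun ε t x => k * J ε t x) (fun t => k * L t) where
  inner ε hε t := (h.inner ε hε t).const_mul k
  outer ε hε := by
    simp_rw [integral_const_mul]
    exact (h.outer ε hε).const_mul k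
  integrable := h.integrable.const_mul k
  tendsto := by
    simp_rw [integral_const_mul]
    exact h.tendsto.const_mul k

theorem congr (h : ConvergesTo J L) (hJ : ∀ ε t x, J ε t x = J' ε t x) (hL : ∀ t, L t = L' t) :
    ConvergesTo J' L' := by
  have h1 : J = J' := by
    funext ε t x
    exact hJ ε t x
  exact h1 ▸ (funext hL : L = L') ▸ h

end ConvergesTo

variable {N : ℕ} {a b c q : Fin N → ℝ → ℝ} {ρ : ℝ → ℝ} {I : Set ℝ} {φ : Field2}

theorem integral_scaled_mul {ε : ℝ} (hε : 0 < ε) (G : ℝ → ℝ) (y : ℝ) :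
    ∫ x, ε⁻¹ * ρ ((x - y) / ε) * G x = ∫ z, ρ z * G (y + ε * z) := by
  have h1 := integral_sub_right_eq_self (fun x => ρ (x / ε) * G (y + ε * (x / ε))) (μ := volume) y
  rw [Measure.integral_comp_div (fun x => ρ x * G (y + ε * x)) ε, abs_of_pos hε,
    smul_eq_mul] at h1
  rw [← inv_mul_cancel_left₀ hε.ne' (∫ z, ρ z * G (y + ε * z)), ← h1, ← integral_const_mul]
  refine integral_congr_ae (Eventually.of_forall fun x => ?_)
  simp only []
  rw [mul_div_cancel₀ _ hε.ne', add_sub_cancel, mul_assoc]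

/-- The mollified momentum concentrates at the peaks. A bounded factor `H` with a limit profile
`H₀ j` at scale `ε` around `qⱼ` contributes the average of this profile against `ρ`. The limit is
taken first in the stretched variable and then in time, each time by dominated convergence;
collision times form a null set. -/
theorem convergesTo_momentum_mul (h : IsMollifier ρ) (hI : IsOpen I)
    (hcoll : (I \ regularTimes I q).Countable) (hc : ∀ j, ContinuousOn (c j) I)
    (hq : ∀ j, ContinuousOn (q j) I) (hφ : IsTestFunction I φ) {H : ℝ → Field2}
    {H₀ : Fin N → ℝ → ℝ → ℝ}
    (hHc : ∀ ε > 0, ContinuousOn (Function.uncurry (H ε)) (I ×ˢ univ))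
    (hHb : ∀ K ⊆ I, IsCompact K → ∃ C, ∀ ε > 0, ∀ t ∈ K, ∀ x, |H ε t x| ≤ C)
    (hHl : ∀ t ∈ regularTimes I q, ∀ j z,
      Tendsto (fun ε => H ε t (q j t + ε * z)) (𝓝[>] 0) (𝓝 (H₀ j t z))) :
    ConvergesTo (fun ε t x => momentum (mollify ρ ε (peakons c q)) t x * (H ε t x * φ t x))
      (fun t => ∑ j, 2 * c j t * ((∫ z, ρ z * H₀ j t z) * φ t (q j t))) := by
  obtain ⟨K, K', hK, hK', hKI, h0, h0'⟩ := hφ.exists_compact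
  obtain ⟨Cφ, hCφ⟩ := hφ.exists_bound
  obtain ⟨C, hC⟩ := hHb K hKI hK
  obtain ⟨M, hM0, hM⟩ := exists_sum_abs_le (a := c) hc hK hKI
  set J : ℝ → Field2 := fun ε t x =>
    momentum (mollify ρ ε (peakons c q)) t x * (H ε t x * φ t x) with hJ
  have hJc : ∀ ε > 0, ContinuousOn (Function.uncurry (J ε)) (I ×ˢ univ) := fun ε hε =>
    (continuousOn_momentum_mollify_peakons h hε hc hq).mul
      ((hHc ε hε).mul hφ.continuous.continuousOn)
  have hJ0 : ∀ ε t x, t ∉ K → J ε t x = 0 := fun ε t x ht => by simp [hJ, h0 t ht]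
  have hJ0' : ∀ ε t x, x ∉ K' → J ε t x = 0 := fun ε t x hx => by simp [hJ, h0' t x hx]
  have hslice : ∀ t ∈ I, ∀ ε > 0, Continuous fun x => H ε t x * φ t x := fun t ht ε hε => by
    have h1 : ContinuousOn (fun x => H ε t x) univ :=
      (hHc ε hε).comp (f := fun x : ℝ => (t, x)) (by fun_prop) fun x _ => ⟨ht, mem_univ x⟩
    exact (continuousOn_univ.1 h1).mul (hφ.contDiff_slice t).continuous
  have hbound : ∀ ε > 0, ∀ t ∈ K, ∀ x, |H ε t x * φ t x| ≤ C * Cφ := fun ε hε t ht x => by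
    rw [abs_mul]
    exact mul_le_mul (hC ε hε t ht x) (hCφ t x) (abs_nonneg _)
      ((abs_nonneg _).trans (hC ε hε t ht x))
  have hinner : ∀ ε > 0, ∀ t, Integrable (J ε t) := fun ε hε t => by
    by_cases ht : t ∈ I
    · have h1 : ContinuousOn (J ε t) univ :=
        (hJc ε hε).comp (f := fun x : ℝ => (t, x)) (by fun_prop) fun x _ => ⟨ht, mem_univ x⟩
      exact (continuousOn_univ.1 h1).integrable_of_hasCompactSupport
        (HasCompactSupport.intro hK' fun x hx => hJ0' ε t x hx)
    · have : J ε t = 0 := funext fun x => hJ0 ε t x fun hh => ht (hKI hh)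
      rw [this]
      exact integrable_zero _ _ _
  have hint0 : ∀ ε t, t ∉ K → ∫ x, J ε t x = 0 := fun ε t ht => by simp [hJ0 ε t _ ht]
  have houter : ∀ ε > 0, Integrable fun t => ∫ x, J ε t x := fun ε hε =>
    integrable_of_continuousOn_of_eq_zero hI hK hKI
      (continuousOn_integral_of_compact_support hK' (hJc ε hε) fun t x _ hx => hJ0' ε t x hx)
      (hint0 ε)
  have hformula : ∀ ε > 0, ∀ t ∈ I, ∫ x, J ε t x = ∑ j, 2 * c j t *
      ∫ z, ρ z * (H ε t (q j t + ε * z) * φ t (q j t + ε * z)) := fun ε hε t ht => by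
    have he : ∀ x, J ε t x = ∑ j, 2 * c j t *
        (ε⁻¹ * ρ ((x - q j t) / ε) * (H ε t x * φ t x)) := fun x => by
      simp only [hJ]
      rw [momentum_mollify_peakons h hε, Finset.sum_mul]
      exact Finset.sum_congr rfl fun j _ => by ring
    simp_rw [he]
    rw [integral_finsetSum]
    · refine Finset.sum_congr rfl fun j _ => ?_
      rw [integral_const_mul, integral_scaled_mul hε]
    · intro j _
      refine (Continuous.integrable_of_hasCompactSupport ?_ ?_).const_mul _
      · have h1 := h.smooth.continuous
        have h2 := hslice t ht ε hε
        exact (by fun_prop : Continuous fun x => ε⁻¹ * ρ ((x - q j t) / ε)).mul h2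
      · exact ((hφ.hasCompactSupport_slice t).mul_left).mul_left
  have hdom : ∀ ε > 0, ∀ t, ‖∫ x, J ε t x‖ ≤ K.indicator (fun _ => 2 * M * (C * Cφ)) t :=
    fun ε hε t => by
    by_cases ht : t ∈ K
    · rw [hformula ε hε t (hKI ht), indicator_of_mem ht, Real.norm_eq_abs]
      have hCC : 0 ≤ C * Cφ := (abs_nonneg _).trans (hbound ε hε t ht 0)
      refine (Finset.abs_sum_le_sum_abs _ _).trans ?_
      calc ∑ j, |2 * c j t * ∫ z, ρ z * (H ε t (q j t + ε * z) * φ t (q j t + ε * z))|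
          ≤ ∑ j, |c j t| * (2 * (C * Cφ)) := Finset.sum_le_sum fun j _ => by
            rw [abs_mul, abs_mul, abs_two]
            have := h.abs_integral_mul_le
              (g := fun z => H ε t (q j t + ε * z) * φ t (q j t + ε * z))
              fun z => hbound ε hε t ht (q j t + ε * z)
            calc _ ≤ 2 * |c j t| * (C * Cφ) := by gcongr
              _ = _ := by ring
        _ = (∑ j, |c j t|) * (2 * (C * Cφ)) := by rw [Finset.sum_mul]
        _ ≤ M * (2 * (C * Cφ)) := by gcongr; exact hM t ht
        _ = _ := by ring
    · rw [hint0 ε t ht, indicator_of_notMem ht, norm_zero]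
  have hdomi : Integrable (K.indicator fun _ => 2 * M * (C * Cφ)) :=
    (integrable_indicator_iff hK.measurableSet).2 (integrableOn_const hK.measure_lt_top.ne)
  have hlim : ∀ᵐ t, Tendsto (fun ε => ∫ x, J ε t x) (𝓝[>] 0)
      (𝓝 (∑ j, 2 * c j t * ((∫ z, ρ z * H₀ j t z) * φ t (q j t)))) := by
    filter_upwards [hcoll.ae_notMem volume] with t ht
    by_cases htK : t ∈ K
    · have htI := hKI htK
      have htr : t ∈ regularTimes I q := by_contra fun hh => ht ⟨htI, hh⟩
      have : Tendsto (fun ε => ∑ j, 2 * c j t *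
          ∫ z, ρ z * (H ε t (q j t + ε * z) * φ t (q j t + ε * z))) (𝓝[>] 0)
          (𝓝 (∑ j, 2 * c j t * ((∫ z, ρ z * H₀ j t z) * φ t (q j t)))) := by
        refine tendsto_finsetSum _ fun j _ => Tendsto.const_mul _ ?_
        have := h.tendsto_integral_mul (C := C * Cφ)
          (g := fun ε z => H ε t (q j t + ε * z) * φ t (q j t + ε * z))
          (g₀ := fun z => H₀ j t z * φ t (q j t))
          (fun ε hε => ((hslice t htI ε hε).comp
            (by fun_prop : Continuous fun z : ℝ => q j t + ε * z)).measurable)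
          (fun ε hε z => hbound ε hε t htK _) (Eventually.of_forall fun z => ?_)
        · simp_rw [← mul_assoc] at this
          simp_rw [integral_mul_const] at this
          simpa only [mul_assoc] using this
        · refine (hHl t htr j z).mul ?_
          have h2 : Continuous fun ε : ℝ => φ t (q j t + ε * z) :=
            (hφ.contDiff_slice t).continuous.comp (by fun_prop)
          simpa using (h2.tendsto 0).mono_left nhdsWithin_le_nhds
      refine this.congr' ?_
      filter_upwards [self_mem_nhdsWithin] with ε hε using (hformula ε hε t htI).symm
    · simp only [hint0 _ t htK, h0 t htK, mul_zero, Finset.sum_const_zero]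
      exact tendsto_const_nhds
  have hmeas : ∀ᶠ ε in 𝓝[>] (0 : ℝ), AEStronglyMeasurable (fun t => ∫ x, J ε t x) volume := by
    filter_upwards [self_mem_nhdsWithin] with ε hε using (houter ε hε).aestronglyMeasurable
  refine ⟨hinner, houter, ?_, ?_⟩
  · -- Dominated convergence passes the bound on to the limit, which is therefore integrable.
    obtain ⟨u, hu⟩ := exists_seq_tendsto (𝓝[>] (0 : ℝ))
    have hu0 : ∀ᶠ n in atTop, 0 < u n := hu.eventually self_mem_nhdsWithin
    obtain ⟨n₀, hn₀⟩ := eventually_atTop.1 hu0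
    have hu' : Tendsto (fun n => u (n + n₀)) atTop (𝓝[>] 0) :=
      hu.comp (tendsto_add_atTop_nat n₀)
    refine hdomi.mono' (aestronglyMeasurable_of_tendsto_ae atTop
      (f := fun n t => ∫ x, J (u (n + n₀)) t x)
      (fun n => (houter _ (hn₀ _ (by lia))).aestronglyMeasurable)
      (hlim.mono fun t ht => ht.comp hu')) ?_
    filter_upwards [hlim] with t ht
    refine le_of_tendsto ht.norm ?_
    filter_upwards [self_mem_nhdsWithin] with ε hε using hdom ε hε t
  · refine tendsto_integral_filter_of_dominated_convergence _ hmeas ?_ hdomi hlim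
    filter_upwards [self_mem_nhdsWithin] with ε hε using Eventually.of_forall (hdom ε hε)

end Limits

/-! ### The weak form of the equations -/

section WeakForm

variable {N : ℕ} {a b c p q r s : Fin N → ℝ → ℝ} {ρ : ℝ → ℝ} {I : Set ℝ} {φ : Field2}

/-- The velocity of the `j`-th peakon in the peakon system. -/
noncomputable def velocity (p r s q : Fin N → ℝ → ℝ) (j : Fin N) (t : ℝ) : ℝ :=
  1 / 6 * (p j t ^ 2 + r j t * s j t)
    - 1 / 2 * ∑ i, ∑ k, (p i t * p k t + r i t * s k t)
        * (1 - Real.sign (q j t - q i t) * Real.sign (q j t - q k t))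
        * Real.exp (-|q j t - q i t| - |q j t - q k t|)

theorem exp_neg_abs_sub_abs (x y : ℝ) :
    Real.exp (-|x| - |y|) = Real.exp (-|x|) * Real.exp (-|y|) := by
  rw [← Real.exp_add, sub_eq_add_neg]

theorem peakons_mul_peakons (a b q : Fin N → ℝ → ℝ) (j : Fin N) (t : ℝ) :
    peakons a q t (q j t) * peakons b q t (q j t)
      = ∑ i, ∑ k, a i t * b k t * Real.exp (-|q j t - q i t| - |q j t - q k t|) := by
  simp_rw [peakons, Finset.sum_mul_sum, exp_neg_abs_sub_abs]
  exact Finset.sum_congr rfl fun i _ => Finset.sum_congr rfl fun k _ => by ring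

theorem slope_mul_slope (a b q : Fin N → ℝ → ℝ) (j : Fin N) (t : ℝ) :
    slope a q j t * slope b q j t
      = ∑ i, ∑ k, a i t * b k t * (Real.sign (q j t - q i t) * Real.sign (q j t - q k t))
          * Real.exp (-|q j t - q i t| - |q j t - q k t|) := by
  simp_rw [slope, neg_mul_neg, Finset.sum_mul_sum, exp_neg_abs_sub_abs]
  exact Finset.sum_congr rfl fun i _ => Finset.sum_congr rfl fun k _ => by ring

theorem W_eq (a b q : Fin N → ℝ → ℝ) (j : Fin N) (t : ℝ) :
    W q a b j t
      = peakons a q t (q j t) * slope b q j t - slope a q j t * peakons b q t (q j t) := by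
  simp_rw [W, peakons, slope, mul_neg, neg_mul, Finset.sum_mul_sum, exp_neg_abs_sub_abs,
    sub_neg_eq_add, neg_add_eq_sub, ← Finset.sum_sub_distrib]
  exact Finset.sum_congr rfl fun i _ => Finset.sum_congr rfl fun k _ => by ring

theorem velocity_eq (p r s q : Fin N → ℝ → ℝ) (j : Fin N) (t : ℝ) :
    velocity p r s q j t = -(1 / 2) *
      ((peakons p q t (q j t) * peakons p q t (q j t) - slope p q j t * slope p q j t
          - 1 / 3 * (p j t * p j t))
        + (peakons r q t (q j t) * peakons s q t (q j t) - slope r q j t * slope s q j t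
          - 1 / 3 * (r j t * s j t))) := by
  rw [peakons_mul_peakons, peakons_mul_peakons, slope_mul_slope, slope_mul_slope]
  have : ∑ i, ∑ k, (p i t * p k t + r i t * s k t)
        * (1 - Real.sign (q j t - q i t) * Real.sign (q j t - q k t))
        * Real.exp (-|q j t - q i t| - |q j t - q k t|)
      = (∑ i, ∑ k, p i t * p k t * Real.exp (-|q j t - q i t| - |q j t - q k t|))
        - (∑ i, ∑ k, p i t * p k t * (Real.sign (q j t - q i t) * Real.sign (q j t - q k t))
          * Real.exp (-|q j t - q i t| - |q j t - q k t|))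
        + ((∑ i, ∑ k, r i t * s k t * Real.exp (-|q j t - q i t| - |q j t - q k t|))
        - ∑ i, ∑ k, r i t * s k t * (Real.sign (q j t - q i t) * Real.sign (q j t - q k t))
          * Real.exp (-|q j t - q i t| - |q j t - q k t|)) := by
    simp_rw [← Finset.sum_sub_distrib, ← Finset.sum_add_distrib]
    exact Finset.sum_congr rfl fun i _ => Finset.sum_congr rfl fun k _ => by ring
  rw [velocity, this]
  ring

theorem exists_bound_mollify_peakons (h : IsMollifier ρ) (ha : ∀ j, ContinuousOn (a j) I)
    {K : Set ℝ} (hKI : K ⊆ I) (hK : IsCompact K) :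
    ∃ M, 0 ≤ M ∧ ∀ ε > 0, ∀ t ∈ K, ∀ x, |mollify ρ ε (peakons a q) t x| ≤ M ∧
      |dx (mollify ρ ε (peakons a q)) t x| ≤ M := by
  obtain ⟨M, hM0, hM⟩ := exists_sum_abs_le ha hK hKI
  refine ⟨M, hM0, fun ε hε t ht x => ?_⟩
  rw [mollify_peakons h hε, dx_mollify_peakons h hε]
  exact ⟨abs_sum_mul_le (fun j => abs_kernel_le h _ _) (hM t ht),
    abs_sum_mul_le (fun j => abs_kernelDeriv_le h _ _) (hM t ht)⟩

theorem abs_mul_sub_mul_le {w x y z A B : ℝ} (hw : |w| ≤ A) (hx : |x| ≤ B) (hy : |y| ≤ A)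
    (hz : |z| ≤ B) : |w * x - y * z| ≤ A * B + A * B := by
  refine (abs_sub _ _).trans ?_
  rw [abs_mul, abs_mul]
  have hA := (abs_nonneg _).trans hw
  gcongr

/-- The self-interaction of the jumps in the product of two first derivatives leaves the mean
`1/3` of `signProfile ρ ^ 2`. -/
theorem convergesTo_speed (h : IsMollifier ρ) (hI : IsOpen I)
    (hcoll : (I \ regularTimes I q).Countable) (hc : ∀ j, ContinuousOn (c j) I)
    (ha : ∀ j, ContinuousOn (a j) I) (hb : ∀ j, ContinuousOn (b j) I)
    (hq : ∀ j, ContinuousOn (q j) I) (hφ : IsTestFunction I φ) :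
    ConvergesTo (fun ε t x => momentum (mollify ρ ε (peakons c q)) t x *
        ((mollify ρ ε (peakons a q) t x * mollify ρ ε (peakons b q) t x
          - dx (mollify ρ ε (peakons a q)) t x * dx (mollify ρ ε (peakons b q)) t x) * φ t x))
      (fun t => ∑ j, 2 * c j t * ((peakons a q t (q j t) * peakons b q t (q j t)
        - slope a q j t * slope b q j t - 1 / 3 * (a j t * b j t)) * φ t (q j t))) := by
  refine (convergesTo_momentum_mul h hI hcoll hc hq hφ
    (H := fun ε t x => mollify ρ ε (peakons a q) t x * mollify ρ ε (peakons b q) t x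
      - dx (mollify ρ ε (peakons a q)) t x * dx (mollify ρ ε (peakons b q)) t x)
    (H₀ := fun j t z => peakons a q t (q j t) * peakons b q t (q j t)
      - (slope a q j t - a j t * signProfile ρ z) * (slope b q j t - b j t * signProfile ρ z))
    (fun ε hε => ?_) (fun K hKI hK => ?_) (fun t ht j z => ?_)).congr (fun _ _ _ => rfl)
    (fun t => Finset.sum_congr rfl fun j _ => ?_)
  · exact ((continuousOn_mollify_peakons h hε ha hq).mul
      (continuousOn_mollify_peakons h hε hb hq)).sub
      ((continuousOn_dx_mollify_peakons h hε ha hq).mul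
        (continuousOn_dx_mollify_peakons h hε hb hq))
  · obtain ⟨A, -, hA⟩ := exists_bound_mollify_peakons (q := q) h ha hKI hK
    obtain ⟨B, -, hB⟩ := exists_bound_mollify_peakons (q := q) h hb hKI hK
    exact ⟨A * B + A * B, fun ε hε t ht x => abs_mul_sub_mul_le (hA ε hε t ht x).1
      (hB ε hε t ht x).1 (hA ε hε t ht x).2 (hB ε hε t ht x).2⟩
  · exact ((tendsto_mollify_peakons h _ _ _).mul (tendsto_mollify_peakons h _ _ _)).sub
      ((tendsto_dx_mollify_peakons h ht j z).mul (tendsto_dx_mollify_peakons h ht j z))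
  · have hS := continuous_signProfile h
    have i0 := h.integrable
    have i1 := h.integrable_mul_continuous hS
    have i2 : Integrable fun z => ρ z * signProfile ρ z ^ 2 :=
      h.integrable_mul_continuous (hS.pow 2)
    have i01 : ∀ A B : ℝ, Integrable fun z => A * ρ z + B * (ρ z * signProfile ρ z) := fun A B =>
      (i0.const_mul A).add (i1.const_mul B)
    have he : ∀ z, ρ z * (peakons a q t (q j t) * peakons b q t (q j t)
        - (slope a q j t - a j t * signProfile ρ z) * (slope b q j t - b j t * signProfile ρ z))
        = (peakons a q t (q j t) * peakons b q t (q j t) - slope a q j t * slope b q j t) * ρ z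
          + (slope a q j t * b j t + a j t * slope b q j t) * (ρ z * signProfile ρ z)
          + -(a j t * b j t) * (ρ z * signProfile ρ z ^ 2) := fun z => by ring
    simp_rw [he]
    rw [integral_add (i01 _ _) (i2.const_mul _),
      integral_add (i0.const_mul _) (i1.const_mul _), integral_const_mul, integral_const_mul,
      integral_const_mul, h.integral_eq_one, integral_mul_signProfile h,
      integral_mul_signProfile_sq h]
    ring

/-- In the antisymmetric products the jumps enter linearly and average to zero. -/
theorem convergesTo_bracket (h : IsMollifier ρ) (hI : IsOpen I)
    (hcoll : (I \ regularTimes I q).Countable) (hc : ∀ j, ContinuousOn (c j) I)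
    (ha : ∀ j, ContinuousOn (a j) I) (hb : ∀ j, ContinuousOn (b j) I)
    (hq : ∀ j, ContinuousOn (q j) I) (hφ : IsTestFunction I φ) :
    ConvergesTo (fun ε t x => momentum (mollify ρ ε (peakons c q)) t x *
        ((mollify ρ ε (peakons a q) t x * dx (mollify ρ ε (peakons b q)) t x
          - dx (mollify ρ ε (peakons a q)) t x * mollify ρ ε (peakons b q) t x) * φ t x))
      (fun t => ∑ j, 2 * c j t * (W q a b j t * φ t (q j t))) := by
  refine (convergesTo_momentum_mul h hI hcoll hc hq hφ
    (H := fun ε t x => mollify ρ ε (peakons a q) t x * dx (mollify ρ ε (peakons b q)) t x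
      - dx (mollify ρ ε (peakons a q)) t x * mollify ρ ε (peakons b q) t x)
    (H₀ := fun j t z => peakons a q t (q j t) * (slope b q j t - b j t * signProfile ρ z)
      - (slope a q j t - a j t * signProfile ρ z) * peakons b q t (q j t))
    (fun ε hε => ?_) (fun K hKI hK => ?_) (fun t ht j z => ?_)).congr (fun _ _ _ => rfl)
    (fun t => Finset.sum_congr rfl fun j _ => ?_)
  · exact ((continuousOn_mollify_peakons h hε ha hq).mul
      (continuousOn_dx_mollify_peakons h hε hb hq)).sub
      ((continuousOn_dx_mollify_peakons h hε ha hq).mul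
        (continuousOn_mollify_peakons h hε hb hq))
  · obtain ⟨A, -, hA⟩ := exists_bound_mollify_peakons (q := q) h ha hKI hK
    obtain ⟨B, -, hB⟩ := exists_bound_mollify_peakons (q := q) h hb hKI hK
    exact ⟨A * B + A * B, fun ε hε t ht x => abs_mul_sub_mul_le (hA ε hε t ht x).1
      (hB ε hε t ht x).2 (hA ε hε t ht x).2 (hB ε hε t ht x).1⟩
  · exact ((tendsto_mollify_peakons h _ _ _).mul (tendsto_dx_mollify_peakons h ht j z)).sub
      ((tendsto_dx_mollify_peakons h ht j z).mul (tendsto_mollify_peakons h _ _ _))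
  · have hS := continuous_signProfile h
    have i0 := h.integrable
    have i1 := h.integrable_mul_continuous hS
    have he : ∀ z, ρ z * (peakons a q t (q j t) * (slope b q j t - b j t * signProfile ρ z)
        - (slope a q j t - a j t * signProfile ρ z) * peakons b q t (q j t))
        = W q a b j t * ρ z + (a j t * peakons b q t (q j t) - peakons a q t (q j t) * b j t)
          * (ρ z * signProfile ρ z) := fun z => by rw [W_eq]; ring
    simp_rw [he]
    rw [integral_add (i0.const_mul _) (i1.const_mul _), integral_const_mul, integral_const_mul,
      h.integral_eq_one, integral_mul_signProfile h]
    ring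

theorem convergesTo_flux (h : IsMollifier ρ) (hI : IsOpen I)
    (hcoll : (I \ regularTimes I q).Countable) (hc : ∀ j, ContinuousOn (c j) I)
    (hp : ∀ j, ContinuousOn (p j) I) (hr : ∀ j, ContinuousOn (r j) I)
    (hs : ∀ j, ContinuousOn (s j) I) (hq : ∀ j, ContinuousOn (q j) I)
    (hφ : IsTestFunction I φ) :
    ConvergesTo (fun ε t x => -(1 / 2 * (momentum (mollify ρ ε (peakons c q)) t x *
        speed (mollify ρ ε (peakons p q)) (mollify ρ ε (peakons r q))
          (mollify ρ ε (peakons s q)) t x) * dx φ t x))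
      (fun t => ∑ j, 2 * c j t * (velocity p r s q j t * dx φ t (q j t))) := by
  refine (((convergesTo_speed h hI hcoll hc hp hp hq hφ.dx).add
    (convergesTo_speed h hI hcoll hc hr hs hq hφ.dx)).const_mul (-(1 / 2))).congr
    (fun ε t x => ?_) (fun t => ?_)
  · simp only [speed]
    ring
  · rw [← Finset.sum_add_distrib, Finset.mul_sum]
    refine Finset.sum_congr rfl fun j _ => ?_
    rw [velocity_eq]
    ring

/-- The integrand of the weak form of the equations `cⱼ' = Rⱼ`, `cⱼ (qⱼ' - Qⱼ) = 0`, tested with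
`φ` along the trajectories. If these equations hold, it is the time derivative of
`∑ⱼ cⱼ(t) φ(t, qⱼ(t))`. -/
noncomputable def transportDensity (c q Q R : Fin N → ℝ → ℝ) (φ : Field2) (t : ℝ) : ℝ :=
  ∑ j, (c j t * (dt φ t (q j t) + Q j t * dx φ t (q j t)) + R j t * φ t (q j t))

theorem exists_isMollifier : ∃ ρ, IsMollifier ρ := by
  let f : ContDiffBump (0 : ℝ) := ⟨1, 2, by norm_num, by norm_num⟩
  exact ⟨f.normed volume, f.contDiff_normed, f.hasCompactSupport_normed, f.nonneg_normed,
    f.integral_normed⟩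

/-- Since `⟨v, φ_t - φ_txx⟩ = 2 ∑ⱼ ∫ cⱼ φ_t(t, qⱼ) dt`, the weak equation amounts to the vanishing
of all integrals of the transport density. -/
theorem holdsWeakly_iff (hI : IsOpen I) (hc : ∀ j, ContinuousOn (c j) I)
    (hq : ∀ j, ContinuousOn (q j) I) {A B : Field2 → Field2 → Field2 → Field2}
    {u₁₁ u₁₂ u₂₁ : Field2} {Q R : Fin N → ℝ → ℝ}
    (hAB : ∀ φ, IsTestFunction I φ → ∀ ρ, IsMollifier ρ → ConvergesTo
      (fun ε t x => -(A (mollify ρ ε u₁₁) (mollify ρ ε u₁₂) (mollify ρ ε u₂₁) t x * dx φ t x)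
        + B (mollify ρ ε u₁₁) (mollify ρ ε u₁₂) (mollify ρ ε u₂₁) t x * φ t x)
      (fun t => ∑ j, 2 * (c j t * Q j t * dx φ t (q j t) + R j t * φ t (q j t)))) :
    (∀ φ, IsTestFunction I φ → Integrable (transportDensity c q Q R φ)) ∧
    (HoldsWeakly I (peakons c q) A B u₁₁ u₁₂ u₂₁ ↔
      ∀ φ, IsTestFunction I φ → ∫ t, transportDensity c q Q R φ t = 0) := by
  obtain ⟨ρ₀, hρ₀⟩ := exists_isMollifier
  have hdt : ∀ φ, IsTestFunction I φ → Integrable fun t => ∑ j, 2 * c j t * dt φ t (q j t) :=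
    fun φ hφ => integrable_finsetSum _ fun j _ =>
      hφ.dt.integrable_mul_along hI ((hc j).const_mul 2) (hq j)
  have he : ∀ φ t, transportDensity c q Q R φ t = 1 / 2 * ((∑ j, 2 * c j t * dt φ t (q j t))
      + ∑ j, 2 * (c j t * Q j t * dx φ t (q j t) + R j t * φ t (q j t))) := fun φ t => by
    rw [transportDensity, ← Finset.sum_add_distrib, Finset.mul_sum]
    exact Finset.sum_congr rfl fun j _ => by ring
  have hint : ∀ φ, IsTestFunction I φ → Integrable (transportDensity c q Q R φ) := fun φ hφ => by
    rw [funext (he φ)]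
    exact ((hdt φ hφ).add (hAB φ hφ ρ₀ hρ₀).integrable).const_mul _
  refine ⟨hint, ?_⟩
  have hkey : ∀ φ, IsTestFunction I φ → ((∫ t, transportDensity c q Q R φ t = 0) ↔
      ∫ t, ∑ j, 2 * (c j t * Q j t * dx φ t (q j t) + R j t * φ t (q j t))
        = -∫ t, ∫ x, peakons c q t x * momentum (dt φ) t x) := fun φ hφ => by
    simp_rw [he, integral_const_mul, integral_peakons_mul_momentum hφ.dt]
    rw [integral_add (hdt φ hφ) (hAB φ hφ ρ₀ hρ₀).integrable]
    constructor <;> intro hh <;> linarith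
  refine forall_congr' fun φ => forall_congr' fun hφ => ?_
  rw [hkey φ hφ]
  constructor
  · exact fun hh => tendsto_nhds_unique (hAB φ hφ ρ₀ hρ₀).tendsto (hh ρ₀ hρ₀)
  · intro hh ρ hρ
    rw [← hh]
    exact (hAB φ hφ ρ hρ).tendsto

end WeakForm

/-! ### The weak form and the differential equations -/

section Equations

variable {N : ℕ} {a b c p q r s : Fin N → ℝ → ℝ} {I : Set ℝ} {φ : Field2}

theorem integral_eq_zero_of_hasDerivAt_off_countable {f f' : ℝ → ℝ} (hf : Continuous f)
    (hc : HasCompactSupport f) {S : Set ℝ} (hS : S.Countable)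
    (hd : ∀ t ∉ S, HasDerivAt f (f' t) t) (hi : Integrable f') : ∫ t, f' t = 0 := by
  have h1 : Tendsto (fun n : ℝ => ∫ t in -n..n, f' t) atTop (𝓝 (∫ t, f' t)) :=
    intervalIntegral_tendsto_integral hi tendsto_neg_atTop_atBot tendsto_id
  have h2 : ∀ n : ℝ, ∫ t in -n..n, f' t = f n - f (-n) := fun n =>
    integral_eq_of_hasDerivAt_off_countable f f' hS hf.continuousOn (fun t ht => hd t ht.2)
      hi.intervalIntegrable
  have h0 : Tendsto f (cocompact ℝ) (𝓝 0) := hc.is_zero_at_infty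
  have h3 : Tendsto (fun n => f n - f (-n)) atTop (𝓝 (0 - 0)) :=
    (h0.mono_left atTop_le_cocompact).sub
      ((h0.mono_left atBot_le_cocompact).comp tendsto_neg_atTop_atBot)
  simp_rw [h2] at h1
  simpa using tendsto_nhds_unique h1 h3

/-- Along solutions the transport density is a total time derivative off the exceptional times. As
the exceptional times are countable and everything is continuous there, collisions contribute
nothing. -/
theorem integral_transportDensity_eq_zero (hI : IsOpen I) (hc : ∀ j, ContinuousOn (c j) I)
    (hq : ∀ j, ContinuousOn (q j) I) {Q R : Fin N → ℝ → ℝ} {S : Set ℝ} (hS : S.Countable)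
    (hcd : ∀ t ∈ I \ S, ∀ j, HasDerivAt (c j) (R j t) t)
    (hqd : ∀ t ∈ I \ S, ∀ j, HasDerivAt (q j) (Q j t) t) (hφ : IsTestFunction I φ)
    (hi : Integrable (transportDensity c q Q R φ)) :
    ∫ t, transportDensity c q Q R φ t = 0 := by
  obtain ⟨K, K', hK, -, hKI, h0, -⟩ := hφ.exists_compact
  have h0s : ∀ t ∉ K, ∑ j, c j t * φ t (q j t) = 0 := fun t ht =>
    Finset.sum_eq_zero fun j _ => by rw [h0 t ht, mul_zero]
  refine integral_eq_zero_of_hasDerivAt_off_countable (f := fun t => ∑ j, c j t * φ t (q j t))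
    (continuous_of_continuousOn_of_eq_zero hI hK.isClosed hKI (continuousOn_finsetSum _ fun j _ =>
      (hc j).mul (hφ.continuousOn_along (hq j))) h0s)
    (HasCompactSupport.intro hK h0s) hS (fun t ht => ?_) hi
  -- Off `I` the parameters are arbitrary, but `φ` vanishes there together with its derivatives.
  by_cases htI : t ∈ I
  · refine (HasDerivAt.fun_sum fun j _ => (hcd t ⟨htI, ht⟩ j).mul
      (hφ.hasDerivAt_along (hqd t ⟨htI, ht⟩ j))).congr_deriv ?_
    exact Finset.sum_congr rfl fun j _ => by ring
  · have htK : t ∉ K := fun hh => htI (hKI hh)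
    have hz : ∀ {ψ : Field2}, IsTestFunction I ψ → ∀ x, ψ t x = 0 := fun {ψ} hψ x =>
      image_eq_zero_of_notMem_tsupport (f := Function.uncurry ψ) (x := (t, x))
        fun hh => htI (hψ.support_subset hh).1
    have h1 : transportDensity c q Q R φ t = 0 :=
      Finset.sum_eq_zero fun j _ => by rw [hz hφ, hz hφ.dx, hz hφ.dt]; ring
    rw [h1]
    refine (hasDerivAt_const t (0 : ℝ)).congr_of_eventuallyEq ?_
    filter_upwards [hK.isClosed.isOpen_compl.mem_nhds htK] with τ hτ using h0s τ hτ

theorem isTestFunction_mul {U : Set ℝ} {θ χ : ℝ → ℝ} (hθ : ContDiff ℝ ∞ θ)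
    (hθc : HasCompactSupport θ) (hθU : tsupport θ ⊆ U) (hχ : ContDiff ℝ ∞ χ)
    (hχc : HasCompactSupport χ) : IsTestFunction U fun t x => θ t * χ x := by
  have hs : tsupport (Function.uncurry fun t x => θ t * χ x) ⊆ tsupport θ ×ˢ tsupport χ := by
    refine closure_minimal ?_ ((isClosed_tsupport θ).prod (isClosed_tsupport χ))
    rintro ⟨t, x⟩ hz
    have hz : θ t * χ x ≠ 0 := hz
    exact ⟨subset_tsupport θ (left_ne_zero_of_mul hz), subset_tsupport χ (right_ne_zero_of_mul hz)⟩
  exact ⟨(hθ.comp contDiff_fst).mul (hχ.comp contDiff_snd),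
    (hθc.isCompact.prod hχc.isCompact).of_isClosed_subset (isClosed_tsupport _) hs,
    fun z hz => ⟨hθU (hs hz).1, mem_univ _⟩⟩

/-- Point masses and their derivatives at distinct points are linearly independent distributions. -/
theorem eq_zero_of_sum_dirac_eq_zero {y γ δ : Fin N → ℝ} (hy : ∀ i j, i ≠ j → y i ≠ y j)
    (h : ∀ χ : ℝ → ℝ, ContDiff ℝ ∞ χ → HasCompactSupport χ →
      ∑ i, (γ i * χ (y i) + δ i * deriv χ (y i)) = 0) (j : Fin N) : γ j = 0 ∧ δ j = 0 := by
  have hopen : {x | ∀ i, i ≠ j → x ≠ y i} ∈ 𝓝 (y j) := by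
    refine eventually_all.2 fun i => ?_
    by_cases hij : i = j
    · simp [hij]
    · filter_upwards [isOpen_ne.mem_nhds (hy j i (Ne.symm hij))] with x hx _ using hx
  -- A bump `f` at `y j` singles out `γ j`, since its derivative vanishes at its maximum `y j`;
  -- the function `(x - y j) f x` then singles out `δ j`.
  obtain ⟨f, hfs, hfc, hf, hfr, hf1⟩ := exists_contDiff_tsupport_subset (n := ⊤) hopen
  have hfd : ∀ x, HasDerivAt f (deriv f x) x := fun x =>
    (hf.differentiable (by simp) x).hasDerivAt
  have hoff : ∀ i, i ≠ j → f (y i) = 0 ∧ deriv f (y i) = 0 := fun i hij => by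
    have hi : y i ∉ tsupport f := fun hh => hfs hh i hij rfl
    exact ⟨image_eq_zero_of_notMem_tsupport hi,
      Function.notMem_support.1 fun hh => hi (support_deriv_subset hh)⟩
  have hmax : deriv f (y j) = 0 := by
    refine IsLocalMax.deriv_eq_zero (Eventually.of_forall fun x => ?_)
    rw [hf1]
    exact (hfr (mem_range_self x)).2
  have h1 := h f hf hfc
  rw [Finset.sum_eq_single j (fun i _ hij => by rw [(hoff i hij).1, (hoff i hij).2]; ring)
    (by simp), hf1, hmax] at h1
  have hg : ∀ x, deriv (fun x => (x - y j) * f x) x = f x + (x - y j) * deriv f x := fun x => by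
    have := (((hasDerivAt_id x).sub_const (y j)).mul (hfd x)).deriv
    rw [one_mul] at this
    exact this
  have h2 := h (fun x => (x - y j) * f x) ((contDiff_id.sub contDiff_const).mul hf) hfc.mul_left
  simp_rw [hg] at h2
  rw [Finset.sum_eq_single j (fun i _ hij => by rw [(hoff i hij).1, (hoff i hij).2]; ring)
    (by simp), hf1] at h2
  constructor <;> linarith

/-- The weak form determines the equations: `cⱼ' = Rⱼ`, and `qⱼ' = Qⱼ` wherever `cⱼ ≠ 0`. Testing
with `θ(t) χ(x)` and integrating by parts in time gives, at each time, a vanishing combination of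
point masses and their derivatives at the points `qⱼ`. -/
theorem eq_of_integral_transportDensity_eq_zero {U : Set ℝ} (hU : IsOpen U)
    (hc : ∀ j, ContDiffOn ℝ 1 (c j) U) (hq : ∀ j, ContDiffOn ℝ 1 (q j) U)
    {Q R : Fin N → ℝ → ℝ} (hQ : ∀ j, ContinuousOn (Q j) U) (hR : ∀ j, ContinuousOn (R j) U)
    (hdist : ∀ t ∈ U, ∀ i j, i ≠ j → q i t ≠ q j t)
    (h : ∀ φ, IsTestFunction U φ → ∫ t, transportDensity c q Q R φ t = 0) {t : ℝ} (ht : t ∈ U)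
    (j : Fin N) : deriv (c j) t = R j t ∧ c j t * (deriv (q j) t - Q j t) = 0 := by
  have hd : ∀ {f : ℝ → ℝ}, ContDiffOn ℝ 1 f U → ∀ τ ∈ U, HasDerivAt f (deriv f τ) τ :=
    fun hf τ hτ =>
      ((hf.differentiableOn (by simp)).differentiableAt (hU.mem_nhds hτ)).hasDerivAt
  have hd' : ∀ {f : ℝ → ℝ}, ContDiffOn ℝ 1 f U → ContinuousOn (deriv f) U :=
    fun hf => hf.continuousOn_deriv_of_isOpen hU (by simp)
  have hcc := fun j => (hc j).continuousOn
  have hqc := fun j => (hq j).continuousOn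
  have hint : ∀ {Q R : Fin N → ℝ → ℝ}, (∀ j, ContinuousOn (Q j) U) →
      (∀ j, ContinuousOn (R j) U) → ∀ φ, IsTestFunction U φ →
      Integrable (transportDensity c q Q R φ) := fun hQ hR φ hφ => by
    refine integrable_finsetSum _ fun j _ => Integrable.add ?_
      (hφ.integrable_mul_along hU (hR j) (hqc j))
    simp_rw [mul_add, ← mul_assoc]
    exact (hφ.dt.integrable_mul_along hU (hcc j) (hqc j)).add
      (hφ.dx.integrable_mul_along hU ((hcc j).mul (hQ j)) (hqc j))
  suffices H : ∀ χ : ℝ → ℝ, ContDiff ℝ ∞ χ → HasCompactSupport χ →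
      ∑ i, ((deriv (c i) t - R i t) * χ (q i t)
        + c i t * (deriv (q i) t - Q i t) * deriv χ (q i t)) = 0 by
    obtain ⟨h1, h2⟩ := eq_zero_of_sum_dirac_eq_zero (hdist t ht) H j
    exact ⟨sub_eq_zero.1 h1, h2⟩
  intro χ hχ hχc
  set G : ℝ → ℝ := fun τ => ∑ i, ((deriv (c i) τ - R i τ) * χ (q i τ)
        + c i τ * (deriv (q i) τ - Q i τ) * deriv χ (q i τ)) with hG
  have hχ' : Continuous (deriv χ) := hχ.continuous_deriv (by simp)
  have hGc : ContinuousOn G U := continuousOn_finsetSum _ fun i _ =>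
    (((hd' (hc i)).sub (hR i)).mul (hχ.continuous.comp_continuousOn (hqc i))).add
      (((hcc i).mul ((hd' (hq i)).sub (hQ i))).mul (hχ'.comp_continuousOn (hqc i)))
  have hG0 : ∀ θ : ℝ → ℝ, ContDiff ℝ ∞ θ → HasCompactSupport θ → tsupport θ ⊆ U →
      ∫ τ, θ τ • G τ = 0 := fun θ hθ hθc hθU => by
    have hφ := isTestFunction_mul hθ hθc hθU hχ hχc
    have i1 := hint (fun j => hd' (hq j)) (fun j => hd' (hc j)) _ hφ
    have i2 := hint hQ hR _ hφ
    have e1 := integral_transportDensity_eq_zero hU hcc hqc (S := ∅) countable_empty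
      (fun τ hτ j => hd (hc j) τ hτ.1) (fun τ hτ j => hd (hq j) τ hτ.1) hφ i1
    have hdx : ∀ τ x, dx (fun t x => θ t * χ x) τ x = θ τ * deriv χ x := fun τ x =>
      deriv_const_mul _ (hχ.differentiable (by simp) x)
    have he : ∀ τ, θ τ • G τ =
        transportDensity c q (fun j => deriv (q j)) (fun j => deriv (c j))
            (fun t x => θ t * χ x) τ
          - transportDensity c q Q R (fun t x => θ t * χ x) τ := fun τ => by
      rw [transportDensity, transportDensity, ← Finset.sum_sub_distrib, hG, smul_eq_mul,
        Finset.mul_sum]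
      exact Finset.sum_congr rfl fun i _ => by rw [hdx]; ring
    simp_rw [he]
    rw [integral_sub i1 i2, e1, h _ hφ, sub_zero]
  have hae := hU.ae_eq_zero_of_integral_contDiff_smul_eq_zero (μ := volume)
    (hGc.locallyIntegrableOn hU.measurableSet) hG0
  exact Measure.eqOn_open_of_ae_eq (f := G) (g := fun _ => 0)
    ((ae_restrict_iff' hU.measurableSet).2 hae) hU hGc continuousOn_const ht

theorem isOpen_regularTimes (hI : IsOpen I) (hq : ∀ j, ContinuousOn (q j) I) :
    IsOpen (regularTimes I q) := by
  refine isOpen_iff_mem_nhds.2 fun t ht => ?_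
  refine inter_mem (hI.mem_nhds ht.1) (eventually_all.2 fun i => eventually_all.2 fun j => ?_)
  by_cases hij : i = j
  · simp [hij]
  · have h1 := ((hq i).continuousAt (hI.mem_nhds ht.1))
    have h2 := ((hq j).continuousAt (hI.mem_nhds ht.1))
    filter_upwards [(h1.sub h2).eventually_ne (sub_ne_zero.2 (ht.2 i j hij))] with τ hτ _
      using sub_ne_zero.1 hτ

theorem continuousOn_slope (ha : ∀ j, ContinuousOn (a j) I)
    (hq : ∀ j, ContinuousOn (q j) I) (j : Fin N) :
    ContinuousOn (slope a q j) (regularTimes I q) := by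
  have hqr : ∀ j, ContinuousOn (q j) (regularTimes I q) := fun j => (hq j).mono fun t ht => ht.1
  refine (continuousOn_finsetSum _ fun i _ => ((ha i).mono fun t ht => ht.1).mul
    (ContinuousOn.mul ?_ ((hqr j).sub (hqr i)).abs.neg.rexp)).neg
  by_cases hij : j = i
  · simp [hij, continuousOn_const]
  · intro t ht
    exact (continuousAt_sign (sub_ne_zero.2 (ht.2 j i hij))).comp_continuousWithinAt
      (f := fun t => q j t - q i t) ((hqr j).sub (hqr i) t ht)

theorem continuousOn_peakons (ha : ∀ j, ContinuousOn (a j) I) (hq : ∀ j, ContinuousOn (q j) I) :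
    ContinuousOn (Function.uncurry (peakons a q)) (I ×ˢ univ) :=
  continuousOn_sum_comp_sub (k := fun x => Real.exp (-|x|)) (by fun_prop) ha hq

theorem continuousOn_peakons_peak (ha : ∀ j, ContinuousOn (a j) I)
    (hq : ∀ j, ContinuousOn (q j) I) (j : Fin N) :
    ContinuousOn (fun t => peakons a q t (q j t)) (regularTimes I q) :=
  (continuousOn_peakons ha hq).comp
    (continuousOn_id.prodMk ((hq j).mono fun _ ht => ht.1)) fun _ ht => ⟨ht.1, mem_univ _⟩

theorem continuousOn_W (ha : ∀ j, ContinuousOn (a j) I)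
    (hb : ∀ j, ContinuousOn (b j) I) (hq : ∀ j, ContinuousOn (q j) I) (j : Fin N) :
    ContinuousOn (W q a b j) (regularTimes I q) := by
  rw [funext (W_eq a b q j)]
  exact ((continuousOn_peakons_peak ha hq j).mul (continuousOn_slope hb hq j)).sub
    ((continuousOn_slope ha hq j).mul (continuousOn_peakons_peak hb hq j))

theorem continuousOn_velocity (hp : ∀ j, ContinuousOn (p j) I)
    (hr : ∀ j, ContinuousOn (r j) I) (hs : ∀ j, ContinuousOn (s j) I)
    (hq : ∀ j, ContinuousOn (q j) I) (j : Fin N) :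
    ContinuousOn (velocity p r s q j) (regularTimes I q) := by
  have hsub : regularTimes I q ⊆ I := fun _ ht => ht.1
  rw [funext (velocity_eq p r s q j)]
  have h1 := continuousOn_peakons_peak hp hq j
  have h2 := continuousOn_peakons_peak hr hq j
  have h3 := continuousOn_peakons_peak hs hq j
  have h4 := continuousOn_slope hp hq j
  have h5 := continuousOn_slope hr hq j
  have h6 := continuousOn_slope hs hq j
  have h7 := (hp j).mono hsub
  have h8 := (hr j).mono hsub
  have h9 := (hs j).mono hsub
  fun_prop

/-- Weak solutions are characterised by the vanishing of the transport densities of the amplitudes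
`p`, `r`, `s`, all carried by the same velocity field. -/
theorem isWeakSolution_iff (hI : IsOpen I) (hcoll : (I \ regularTimes I q).Countable)
    (hp : ∀ j, ContinuousOn (p j) I) (hr : ∀ j, ContinuousOn (r j) I)
    (hs : ∀ j, ContinuousOn (s j) I) (hq : ∀ j, ContinuousOn (q j) I)
    {R₁₁ R₁₂ R₂₁ : Fin N → ℝ → ℝ}
    (h₁₁ : ∀ j t, R₁₁ j t = -(1 / 2) * r j t * W q p s j t - 1 / 2 * s j t * W q p r j t)
    (h₁₂ : ∀ j t, R₁₂ j t = p j t * W q p r j t - 1 / 2 * r j t * W q r s j t)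
    (h₂₁ : ∀ j t, R₂₁ j t = p j t * W q p s j t + 1 / 2 * s j t * W q r s j t) :
    (∀ φ, IsTestFunction I φ → Integrable (transportDensity p q (velocity p r s q) R₁₁ φ) ∧
      Integrable (transportDensity r q (velocity p r s q) R₁₂ φ) ∧
      Integrable (transportDensity s q (velocity p r s q) R₂₁ φ)) ∧
    (IsWeakSolution I (peakons p q) (peakons r q) (peakons s q) ↔
      ∀ φ, IsTestFunction I φ → ∫ t, transportDensity p q (velocity p r s q) R₁₁ φ t = 0 ∧
        ∫ t, transportDensity r q (velocity p r s q) R₁₂ φ t = 0 ∧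
        ∫ t, transportDensity s q (velocity p r s q) R₂₁ φ t = 0) := by
  obtain ⟨i₁, e₁⟩ := holdsWeakly_iff (c := p) (Q := velocity p r s q) (R := R₁₁) (A := flux₁₁)
      (B := source₁₁) (u₁₁ := peakons p q) (u₁₂ := peakons r q) (u₂₁ := peakons s q) hI hp hq
      fun φ hφ ρ hρ => by
    refine (((convergesTo_flux hρ hI hcoll hp hp hr hs hq hφ).add
      ((convergesTo_bracket hρ hI hcoll hr hp hs hq hφ).const_mul (-(1 / 2)))).add
      ((convergesTo_bracket hρ hI hcoll hs hp hr hq hφ).const_mul (-(1 / 2)))).congr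
      (fun ε t x => ?_) (fun t => ?_)
    · simp only [flux₁₁, source₁₁]
      ring
    · rw [Finset.mul_sum, Finset.mul_sum, ← Finset.sum_add_distrib, ← Finset.sum_add_distrib]
      exact Finset.sum_congr rfl fun j _ => by rw [h₁₁]; ring
  obtain ⟨i₂, e₂⟩ := holdsWeakly_iff (c := r) (Q := velocity p r s q) (R := R₁₂) (A := flux₁₂)
      (B := source₁₂) (u₁₁ := peakons p q) (u₁₂ := peakons r q) (u₂₁ := peakons s q) hI hr hq
      fun φ hφ ρ hρ => by
    refine (((convergesTo_flux hρ hI hcoll hr hp hr hs hq hφ).add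
      (convergesTo_bracket hρ hI hcoll hp hp hr hq hφ)).add
      ((convergesTo_bracket hρ hI hcoll hr hr hs hq hφ).const_mul (-(1 / 2)))).congr
      (fun ε t x => ?_) (fun t => ?_)
    · simp only [flux₁₂, source₁₂]
      ring
    · rw [Finset.mul_sum, ← Finset.sum_add_distrib, ← Finset.sum_add_distrib]
      exact Finset.sum_congr rfl fun j _ => by rw [h₁₂]; ring
  obtain ⟨i₃, e₃⟩ := holdsWeakly_iff (c := s) (Q := velocity p r s q) (R := R₂₁) (A := flux₂₁)
      (B := source₂₁) (u₁₁ := peakons p q) (u₁₂ := peakons r q) (u₂₁ := peakons s q) hI hs hq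
      fun φ hφ ρ hρ => by
    refine (((convergesTo_flux hρ hI hcoll hs hp hr hs hq hφ).add
      (convergesTo_bracket hρ hI hcoll hp hp hs hq hφ)).add
      ((convergesTo_bracket hρ hI hcoll hs hr hs hq hφ).const_mul (1 / 2))).congr
      (fun ε t x => ?_) (fun t => ?_)
    · simp only [flux₂₁, source₂₁]
      ring
    · rw [Finset.mul_sum, ← Finset.sum_add_distrib, ← Finset.sum_add_distrib]
      exact Finset.sum_congr rfl fun j _ => by rw [h₂₁]; ring
  refine ⟨fun φ hφ => ⟨i₁ φ hφ, i₂ φ hφ, i₃ φ hφ⟩, fun h φ hφ =>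
    ⟨e₁.1 h.eq₁₁ φ hφ, e₂.1 h.eq₁₂ φ hφ, e₃.1 h.eq₂₁ φ hφ⟩, fun h => ?_⟩
  exact ⟨continuousOn_peakons hp hq, continuousOn_peakons hr hq, continuousOn_peakons hs hq,
    e₁.2 fun φ hφ => (h φ hφ).1, e₂.2 fun φ hφ => (h φ hφ).2.1, e₃.2 fun φ hφ => (h φ hφ).2.2⟩

end Equations

end ThreeCH

theorem mainTheorem4 (N : ℕ) (I : Set ℝ) (hI : IsOpen I)
    (p r s q : Fin N → ℝ → ℝ)
    (hcont : ∀ j, ContinuousOn (p j) I ∧ ContinuousOn (r j) I ∧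
      ContinuousOn (s j) I ∧ ContinuousOn (q j) I)
    (hcoll : (I \ ThreeCH.regularTimes I q).Countable)
    (hreg : ∀ j, ContDiffOn ℝ 1 (p j) (ThreeCH.regularTimes I q) ∧
      ContDiffOn ℝ 1 (r j) (ThreeCH.regularTimes I q) ∧
      ContDiffOn ℝ 1 (s j) (ThreeCH.regularTimes I q) ∧
      ContDiffOn ℝ 1 (q j) (ThreeCH.regularTimes I q)) :
    ((∀ t ∈ ThreeCH.regularTimes I q, ThreeCH.PeakonODEAt p r s q t) →
      ThreeCH.IsWeakSolution I
        (ThreeCH.peakons p q) (ThreeCH.peakons r q) (ThreeCH.peakons s q)) ∧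
    ((∀ j, ∀ t ∈ ThreeCH.regularTimes I q, p j t ≠ 0 ∨ r j t ≠ 0 ∨ s j t ≠ 0) →
      (ThreeCH.IsWeakSolution I
          (ThreeCH.peakons p q) (ThreeCH.peakons r q) (ThreeCH.peakons s q) ↔
        ∀ t ∈ ThreeCH.regularTimes I q, ThreeCH.PeakonODEAt p r s q t)) := by
  have hp := fun j => (hcont j).1
  have hr := fun j => (hcont j).2.1
  have hs := fun j => (hcont j).2.2.1
  have hq := fun j => (hcont j).2.2.2
  obtain ⟨hint, hiff⟩ := ThreeCH.isWeakSolution_iff hI hcoll hp hr hs hq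
    (fun _ _ => rfl) (fun _ _ => rfl) (fun _ _ => rfl)
  have hforward : (∀ t ∈ ThreeCH.regularTimes I q, ThreeCH.PeakonODEAt p r s q t) →
      ThreeCH.IsWeakSolution I
        (ThreeCH.peakons p q) (ThreeCH.peakons r q) (ThreeCH.peakons s q) := by
    intro h
    have hmem : ∀ t ∈ I \ (I \ ThreeCH.regularTimes I q), ThreeCH.PeakonODEAt p r s q t :=
      fun t ht => h t (by_contra fun hh => ht.2 ⟨ht.1, hh⟩)
    refine hiff.2 fun φ hφ => ?_
    obtain ⟨i₁, i₂, i₃⟩ := hint φ hφ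
    exact ⟨ThreeCH.integral_transportDensity_eq_zero hI hp hq hcoll (fun t ht => (hmem t ht).p_eq)
        (fun t ht => (hmem t ht).q_eq) hφ i₁,
      ThreeCH.integral_transportDensity_eq_zero hI hr hq hcoll (fun t ht => (hmem t ht).r_eq)
        (fun t ht => (hmem t ht).q_eq) hφ i₂,
      ThreeCH.integral_transportDensity_eq_zero hI hs hq hcoll (fun t ht => (hmem t ht).s_eq)
        (fun t ht => (hmem t ht).q_eq) hφ i₃⟩
  refine ⟨hforward, fun hvoid => ⟨fun hweak => ?_, hforward⟩⟩
  have hsub : ThreeCH.regularTimes I q ⊆ I := fun _ ht => ht.1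
  have hopen := ThreeCH.isOpen_regularTimes hI hq
  have htest : ∀ φ, ThreeCH.IsTestFunction (ThreeCH.regularTimes I q) φ →
      ThreeCH.IsTestFunction I φ := fun φ hφ =>
    ⟨hφ.smooth, hφ.compact, hφ.support_subset.trans (Set.prod_mono_left hsub)⟩
  have hp' := fun j => (hreg j).1
  have hr' := fun j => (hreg j).2.1
  have hs' := fun j => (hreg j).2.2.1
  have hq' := fun j => (hreg j).2.2.2
  have hQ := ThreeCH.continuousOn_velocity hp hr hs hq
  have hW : ∀ {a b : Fin N → ℝ → ℝ}, (∀ j, ContinuousOn (a j) I) → (∀ j, ContinuousOn (b j) I) →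
      ∀ j, ContinuousOn (ThreeCH.W q a b j) (ThreeCH.regularTimes I q) :=
    fun ha hb => ThreeCH.continuousOn_W ha hb hq
  have hm : ∀ {a : Fin N → ℝ → ℝ}, (∀ j, ContinuousOn (a j) I) → ∀ j,
      ContinuousOn (a j) (ThreeCH.regularTimes I q) := fun ha j => (ha j).mono hsub
  intro t ht
  have e₁ := ThreeCH.eq_of_integral_transportDensity_eq_zero hopen hp' hq' hQ
    (fun j => (((hm hr j).const_mul (-(1 / 2))).mul (hW hp hs j)).sub
      (((hm hs j).const_mul (1 / 2)).mul (hW hp hr j)))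
    (fun t ht => ht.2) (fun φ hφ => (hiff.1 hweak φ (htest φ hφ)).1) ht
  have e₂ := ThreeCH.eq_of_integral_transportDensity_eq_zero hopen hr' hq' hQ
    (fun j => ((hm hp j).mul (hW hp hr j)).sub
      (((hm hr j).const_mul (1 / 2)).mul (hW hr hs j)))
    (fun t ht => ht.2) (fun φ hφ => (hiff.1 hweak φ (htest φ hφ)).2.1) ht
  have e₃ := ThreeCH.eq_of_integral_transportDensity_eq_zero hopen hs' hq' hQ
    (fun j => ((hm hp j).mul (hW hp hs j)).add
      (((hm hs j).const_mul (1 / 2)).mul (hW hr hs j)))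
    (fun t ht => ht.2) (fun φ hφ => (hiff.1 hweak φ (htest φ hφ)).2.2) ht
  have hd : ∀ {f : ℝ → ℝ} {f' : ℝ}, ContDiffOn ℝ 1 f (ThreeCH.regularTimes I q) →
      deriv f t = f' → HasDerivAt f f' t := fun hf hh =>
    hh ▸ ((hf.differentiableOn (by simp)).differentiableAt (hopen.mem_nhds ht)).hasDerivAt
  refine ⟨fun j => hd (hp' j) (e₁ j).1, fun j => hd (hr' j) (e₂ j).1,
    fun j => hd (hs' j) (e₃ j).1, fun j => hd (hq' j) (sub_eq_zero.1 ?_)⟩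
  rcases hvoid j t ht with h | h | h
  · exact (mul_eq_zero.1 (e₁ j).2).resolve_left h
  · exact (mul_eq_zero.1 (e₂ j).2).resolve_left h
  · exact (mul_eq_zero.1 (e₃ j).2).resolve_left h
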